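/- Let $(\mathcal X,\mathcal B,m,T)$ be an ergodic, aperiodic probability preserving system; that is, $(\mathcal X,\mathcal B,m)$ is a standard probability space (a standard Borel space with a probability measure), $T:\mathcal X\to\mathcal X$ is measurable with $m\circ T^{-1}=m$ (and not necessarily invertible), every $B\in\mathcal B$ with $T^{-1}B=B$ satisfies $m(B)\in\{0,1\}$, and the set of periodic points $\{x:\ T^nx=x\text{ for some }n\ge 1\}$ is $m$-null. For every $\alpha\in(0,2)$ and $\sigma>0$ there exists a measurable function $f:\mathcal X\to\mathbb R$ such that, with $S_n(f)=\sum_{k=0}^{n-1}f\circ T^k$, the random variables $\frac{1}{n^{1/\alpha}}S_n(f)$ on $(\mathcal X,\mathcal B,m)$ converge in distribution, as $n\to\infty$, to a symmetric $\alpha$-stable random variable with dispersion parameter $\sigma$, i.e. to the probability law $S\alpha S(\sigma)$ on $\mathbb R$ whose characteristic function is $\theta\mapsto\exp(-\sigma^\alpha|\theta|^\alpha)$, $\theta\in\mathbb R$. -/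

import Mathlib

open MeasureTheory Filter

/-- `ν` is the symmetric `α`-stable law `SαS(σ)` with dispersion parameter `σ`: the probability
measure on `ℝ` with characteristic function `θ ↦ exp (-σ ^ α * |θ| ^ α)`
(meaningful for `0 < α ≤ 2` and `0 < σ`). -/
def IsSymmetricStable (α σ : ℝ) (ν : ProbabilityMeasure ℝ) : Prop :=
  ∀ θ : ℝ, charFun (ν : Measure ℝ) θ = ((Real.exp (-(σ ^ α * |θ| ^ α)) : ℝ) : ℂ)

/-- `T` is aperiodic with respect to `m`: the set of all periodic points of `T` is `m`-null. -/
def IsAperiodic {X : Type*} [MeasurableSpace X] (T : X → X) (m : Measure X) : Prop :=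
  m (Function.periodicPts T) = 0

/-!
The observable is a series `f = ∑ k, (W k - W k ∘ T^(d k))` of coboundaries with `d k = 8 ^ k`. The
values of `W k` are distributed approximately as `X * 1[a k < |X| ≤ a (k + 1)]`, where `X` has the
symmetric Pareto law of exponent `α` and `a k = 4 ^ (k / α)`; moreover the block
`W k, W k ∘ T, …, W k ∘ T^(2 * d k - 1)` is approximately independent and identically distributed,
and approximately independent of the earlier components.

Such `W k` exist in every aperiodic system, without a Rokhlin tower (`exists_label`): cut the space
into very fine cells and give each cell a random label, independently with the prescribed law.
By aperiodicity, and since the measure has no atoms, the first points of the orbits of almost all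
pairs `(x, y)` lie in pairwise distinct cells once the partition is fine enough. The label blocks
read along the orbits of `x` and `y` are then independent, so that the empirical law of the blocks
has small variance over the random labels, and some choice of labels is good for any prescribed
finite set of tests (`integral_norm_sq_le_collisionSet`). For the tests to control characteristic
functions uniformly on bounded sets of frequencies, a finite net suffices (`exists_component`).

Given `n`, let `K` be the least integer with `n ≤ d K`. For `k ≥ K` the Birkhoff sum of the `k`-th
coboundary is a signed sum of `2 * n` nearly independent variables, so that these components
together have a characteristic function close to
`exp (-2 n ∫ (1 - cos (t x)) α x ^ (-1 - α))`, the integral being over `x > a K`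
(`norm_sub_exp_sum_le`); this needs `n * (a K) ^ (-2 * α) → 0`. For `k < K` the coboundary structure
bounds the Birkhoff sum in `L¹` by twice that of `S_{d k} (W k)`, uniformly in time, hence by
`2 * (d k) ^ (1/2) * a (k + 1) * (a k) ^ (-α / 2)` up to a small error; the sum of these bounds is
`o (n ^ (1 / α))` because `α < 2`. At frequency `t = θ / n ^ (1 / α)` the self-similarity of the Lévy
density turns the exponent into `-2 |θ| ^ α ∫ (1 - cos u) α u ^ (-1 - α)` over `u > |t| * a K`,
where `|t| * a K → 0`, and the stable characteristic function appears in the limit. The limit law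
itself is obtained from tightness and Prokhorov's theorem, and the dispersion parameter is adjusted
by rescaling `f`.
-/

/-! ### Random labels along orbits -/

section Labels

open ProbabilityTheory Topology

variable {X : Type*} [MeasurableSpace X] {T : X → X} {m : Measure X}

/-- An atom would return to itself by Poincaré recurrence, hence be periodic. -/
theorem measure_singleton_eq_zero_of_isAperiodic [MeasurableSingletonClass X] [IsFiniteMeasure m]
    (hT : MeasurePreserving T m m) (hap : IsAperiodic T m) (x : X) : m {x} = 0 := by
  by_contra hx
  obtain ⟨y, hy, n, hn, hny⟩ :=
    hT.exists_mem_iterate_mem (measurableSet_singleton x).nullMeasurableSet hx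
  rw [Set.mem_singleton_iff] at hy hny
  subst hy
  refine hx (measure_mono_null ?_ hap)
  rintro _ rfl
  exact ⟨n, Nat.pos_of_ne_zero hn, hny⟩

theorem ae_iterate_ne_iterate (hT : MeasurePreserving T m m) (hap : IsAperiodic T m) {i j : ℕ}
    (hij : i < j) : ∀ᵐ x ∂m, T^[i] x ≠ T^[j] x := by
  have h0 : m (T^[i] ⁻¹' Function.periodicPts T) = 0 :=
    (hT.iterate i).quasiMeasurePreserving.preimage_null hap
  refine measure_mono_null (fun x hx => ?_) h0
  simp only [Set.mem_compl_iff, Set.mem_ofPred_eq, not_not] at hx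
  refine ⟨j - i, by omega, ?_⟩
  change T^[j - i] (T^[i] x) = T^[i] x
  rw [← Function.iterate_add_apply, Nat.sub_add_cancel hij.le]
  exact hx.symm

theorem ae_prod_iterate_ne_iterate [StandardBorelSpace X] [IsFiniteMeasure m]
    (hT : MeasurePreserving T m m) (hap : IsAperiodic T m) (i j : ℕ) :
    ∀ᵐ p ∂m.prod m, T^[i] p.1 ≠ T^[j] p.2 := by
  have hmeas : MeasurableSet {p : X × X | T^[i] p.1 ≠ T^[j] p.2} :=
    (measurableSet_eq_fun ((hT.measurable.iterate i).comp measurable_fst)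
      ((hT.measurable.iterate j).comp measurable_snd)).compl
  rw [Measure.ae_prod_iff_ae_ae hmeas]
  refine Eventually.of_forall fun x => ?_
  have h0 : m (T^[j] ⁻¹' {T^[i] x}) = 0 :=
    (hT.iterate j).quasiMeasurePreserving.preimage_null
      (measure_singleton_eq_zero_of_isAperiodic hT hap _)
  refine measure_mono_null (fun y hy => ?_) h0
  simp only [Set.mem_compl_iff, Set.mem_ofPred_eq, not_not] at hy
  exact hy.symm

/-- The concatenation of the orbit segments of length `N` of two points. -/
def orbitPair (T : X → X) (N : ℕ) (p : X × X) : Fin N ⊕ Fin N → X :=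
  Sum.elim (fun i => T^[i] p.1) (fun i => T^[i] p.2)

theorem ae_injective_orbitPair [StandardBorelSpace X] [IsFiniteMeasure m]
    (hT : MeasurePreserving T m m) (hap : IsAperiodic T m) (N : ℕ) :
    ∀ᵐ p ∂m.prod m, Function.Injective (orbitPair T N p) := by
  have h1 : ∀ᵐ p ∂m.prod m, ∀ i j : ℕ, i < j → T^[i] p.1 ≠ T^[j] p.1 :=
    Measure.quasiMeasurePreserving_fst.ae
      (ae_all_iff.2 fun i => ae_all_iff.2 fun j => ae_all_iff.2 (ae_iterate_ne_iterate hT hap))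
  have h2 : ∀ᵐ p ∂m.prod m, ∀ i j : ℕ, i < j → T^[i] p.2 ≠ T^[j] p.2 :=
    Measure.quasiMeasurePreserving_snd.ae
      (ae_all_iff.2 fun i => ae_all_iff.2 fun j => ae_all_iff.2 (ae_iterate_ne_iterate hT hap))
  have h3 : ∀ᵐ p ∂m.prod m, ∀ i j : ℕ, T^[i] p.1 ≠ T^[j] p.2 :=
    ae_all_iff.2 fun i => ae_all_iff.2 fun j => ae_prod_iterate_ne_iterate hT hap i j
  filter_upwards [h1, h2, h3] with p h1 h2 h3
  refine Function.Injective.sumElim ?_ ?_ fun i j => h3 i j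
  · intro i j hij
    rcases lt_trichotomy (i : ℕ) j with h | h | h
    · exact absurd hij (h1 _ _ h)
    · exact Fin.ext h
    · exact absurd hij.symm (h1 _ _ h)
  · intro i j hij
    rcases lt_trichotomy (i : ℕ) j with h | h | h
    · exact absurd hij (h2 _ _ h)
    · exact Fin.ext h
    · exact absurd hij.symm (h2 _ _ h)

/-- The cell of a point in the `q`-th of a refining sequence of finite measurable partitions which
separates points. -/
noncomputable def cell (X : Type*) [MeasurableSpace X] [MeasurableSpace.CountablyGenerated X]
    (q : ℕ) (x : X) : Fin q → Bool :=
  fun i => MeasurableSpace.mapNatBool X x i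

theorem measurable_cell [MeasurableSpace.CountablyGenerated X] (q : ℕ) :
    Measurable (cell X q) :=
  measurable_pi_lambda _ fun i =>
    (measurable_pi_apply (i : ℕ)).comp (MeasurableSpace.measurable_mapNatBool X)

theorem eventually_cell_ne [StandardBorelSpace X] {x y : X} (hxy : x ≠ y) :
    ∀ᶠ q in atTop, cell X q x ≠ cell X q y := by
  have h := (MeasurableSpace.injective_mapNatBool X).ne hxy
  obtain ⟨i, hi⟩ := Function.ne_iff.1 h
  filter_upwards [eventually_gt_atTop i] with q hq heq
  exact hi (congrFun heq ⟨i, hq⟩)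

theorem eventually_injective_cell_comp [StandardBorelSpace X] {ι : Type*} [Finite ι] {u : ι → X}
    (hu : Function.Injective u) :
    ∀ᶠ q in atTop, Function.Injective fun i => cell X q (u i) := by
  have : ∀ᶠ q in atTop, ∀ i j, i ≠ j → cell X q (u i) ≠ cell X q (u j) := by
    simp only [eventually_all]
    exact fun i j hij => eventually_cell_ne (hu.ne hij)
  filter_upwards [this] with q hq i j hij
  by_contra hne
  exact hq i j hne hij

/-- The pairs of points whose orbit segments of length `N` do not meet `2 * N` distinct cells. -/
def collisionSet [MeasurableSpace.CountablyGenerated X] (T : X → X) (N q : ℕ) : Set (X × X) :=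
  {p | ¬ Function.Injective fun i => cell X q (orbitPair T N p i)}

theorem measurable_orbitPair (hT : Measurable T) (N : ℕ) (i : Fin N ⊕ Fin N) :
    Measurable fun p : X × X => orbitPair T N p i := by
  cases i with
  | inl i => exact (hT.iterate i).comp measurable_fst
  | inr i => exact (hT.iterate i).comp measurable_snd

theorem measurableSet_collisionSet [MeasurableSpace.CountablyGenerated X] (hT : Measurable T)
    (N q : ℕ) : MeasurableSet (collisionSet (X := X) T N q) := by
  have h : Measurable fun p : X × X => fun i => cell X q (orbitPair T N p i) :=
    measurable_pi_lambda _ fun i => (measurable_cell q).comp (measurable_orbitPair hT N i)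
  exact h (MeasurableSet.of_discrete (s := {v | ¬ Function.Injective v}))

theorem tendsto_measure_collisionSet [StandardBorelSpace X] [IsFiniteMeasure m]
    (hT : MeasurePreserving T m m) (hap : IsAperiodic T m) (N : ℕ) :
    Tendsto (fun q => (m.prod m).real (collisionSet (X := X) T N q)) atTop (𝓝 0) := by
  have key : Tendsto (fun q => ∫ p, (collisionSet (X := X) T N q).indicator
      (fun _ => (1 : ℝ)) p ∂m.prod m) atTop (𝓝 (∫ _, (0 : ℝ) ∂m.prod m)) := by
    refine tendsto_integral_of_dominated_convergence (fun _ => 1)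
      (fun q => (aestronglyMeasurable_const.indicator
        (measurableSet_collisionSet hT.measurable N q))) (integrable_const _)
      (fun q => Eventually.of_forall fun p => ?_) ?_
    · by_cases hp : p ∈ collisionSet (X := X) T N q <;> simp [hp]
    · filter_upwards [ae_injective_orbitPair hT hap N] with p hp
      refine tendsto_const_nhds.congr' ?_
      filter_upwards [eventually_injective_cell_comp hp] with q hq
      exact (Set.indicator_of_notMem (s := collisionSet T N q) (not_not.2 hq) _).symm
  simpa [integral_indicator_const, measurableSet_collisionSet hT.measurable] using key

variable {Ω : Type*} [MeasurableSpace Ω] {ρ : Measure Ω} [IsProbabilityMeasure ρ]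

/-- Reading a product measure along an injection of the index set gives a product measure. -/
theorem measurePreserving_comp_injective {κ κ' : Type*} [Fintype κ] [Fintype κ'] {u : κ' → κ}
    (hu : Function.Injective u) :
    MeasurePreserving (fun (ω : κ → Ω) i => ω (u i))
      (Measure.pi fun _ => ρ) (Measure.pi fun _ => ρ) := by
  refine ⟨measurable_pi_lambda _ fun i => measurable_pi_apply _, ?_⟩
  have h := (iIndepFun_pi (μ := fun _ : κ => ρ) (X := fun _ => id)
    (fun _ => aemeasurable_id)).precomp hu
  have h' := (iIndepFun_iff_map_fun_eq_pi_map
    (fun i => (measurable_pi_apply (u i)).aemeasurable)).1 h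
  refine h'.trans ?_
  congr 1
  ext1 i
  exact (measurePreserving_eval (fun _ : κ => ρ) (u i)).map_eq

/-- Two blocks read at disjoint sets of indices are independent under a product measure. -/
theorem integral_mul_conj_of_injective {κ : Type*} [Fintype κ] {N : ℕ} {u : Fin N ⊕ Fin N → κ}
    (hu : Function.Injective u) {h : (Fin N → Ω) → ℂ} (hh : Measurable h) :
    ∫ ω : κ → Ω, h (fun i => ω (u (.inl i))) * (starRingEnd ℂ) (h (fun i => ω (u (.inr i))))
        ∂Measure.pi (fun _ => ρ)
      = (∫ v, h v ∂Measure.pi fun _ => ρ) *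
        (starRingEnd ℂ) (∫ v, h v ∂Measure.pi fun _ => ρ) := by
  have hconj : Measurable (starRingEnd ℂ) := Complex.continuous_conj.measurable
  have hF : Measurable fun w : Fin N ⊕ Fin N → Ω =>
      h (fun i => w (.inl i)) * (starRingEnd ℂ) (h (fun i => w (.inr i))) :=
    (hh.comp (measurable_pi_lambda _ fun i => measurable_pi_apply _)).mul
      (hconj.comp (hh.comp (measurable_pi_lambda _ fun i => measurable_pi_apply _)))
  have hp := measurePreserving_comp_injective (ρ := ρ) hu
  rw [← integral_conj, ← integral_prod_mul]
  have e1 := integral_map (μ := Measure.pi fun _ : κ => ρ) hp.measurable.aemeasurable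
    (hF.aestronglyMeasurable)
  rw [hp.map_eq] at e1
  refine e1.symm.trans ?_
  exact (measurePreserving_sumPiEquivProdPi (X := fun _ : Fin N ⊕ Fin N => Ω)
    (fun _ => ρ)).integral_comp' (g := fun z : (Fin N → Ω) × (Fin N → Ω) =>
      h z.1 * (starRingEnd ℂ) (h z.2))

/-- The orbit segment of length `N` of a point, read through a labelling `ω` of the cells. -/
noncomputable def labelBlock [MeasurableSpace.CountablyGenerated X] (T : X → X) (N q : ℕ)
    (ω : (Fin q → Bool) → Ω) (x : X) : Fin N → Ω :=
  fun i => ω (cell X q (T^[i] x))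

theorem measurable_labelBlock [MeasurableSpace.CountablyGenerated X] (hT : Measurable T)
    (N q : ℕ) : Measurable fun z : ((Fin q → Bool) → Ω) × X => labelBlock T N q z.1 z.2 := by
  refine measurable_pi_lambda _ fun i => ?_
  have h2 : Measurable fun z : ((Fin q → Bool) → Ω) × X => cell X q (T^[i] z.2) :=
    (measurable_cell q).comp ((hT.iterate i).comp measurable_snd)
  have h3 : Measurable fun z : ((Fin q → Bool) → Ω) × (Fin q → Bool) => z.1 z.2 :=
    measurable_from_prod_countable_left fun c => measurable_pi_apply c
  exact h3.comp (measurable_fst.prodMk h2)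

/-- Random labels satisfy the product rule in mean square, up to the probability of a collision:
for a pair of points without collision the two label blocks are independent. -/
theorem integral_norm_sq_le_collisionSet [StandardBorelSpace X] [IsProbabilityMeasure m]
    (hT : MeasurePreserving T m m) (N q : ℕ) {g : X → ℂ} (hg : Measurable g)
    {h : (Fin N → Ω) → ℂ} (hh : Measurable h) {C : ℝ} (hgb : ∀ x, ‖g x‖ ≤ 1)
    (hhb : ∀ v, ‖h v‖ ≤ C) :
    ∫ ω, ‖(∫ x, g x * h (labelBlock T N q ω x) ∂m)
        - (∫ x, g x ∂m) * ∫ v, h v ∂Measure.pi fun _ => ρ‖ ^ 2 ∂Measure.pi (fun _ => ρ)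
      ≤ (2 * C) ^ 2 * (m.prod m).real (collisionSet T N q) := by
  set c := ∫ v, h v ∂Measure.pi fun _ : Fin N => ρ with hc
  have hC : 0 ≤ C := (norm_nonneg _).trans (hhb (fun _ => (Classical.choice
    (nonempty_of_isProbabilityMeasure ρ))))
  have hcb : ‖c‖ ≤ C := by
    refine (norm_integral_le_of_norm_le_const (Eventually.of_forall hhb)).trans ?_
    simp
  have hblk := measurable_labelBlock (Ω := Ω) hT.measurable N q
  set h' : (Fin N → Ω) → ℂ := fun v => h v - c with hh'
  have hh'm : Measurable h' := hh.sub_const c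
  have hh'b : ∀ v, ‖h' v‖ ≤ 2 * C := fun v => by
    refine (norm_sub_le _ _).trans ?_
    linarith [hhb v]
  have hh'int : ∫ v, h' v ∂Measure.pi (fun _ : Fin N => ρ) = 0 := by
    rw [hh', integral_sub, integral_const, ← hc]
    · simp
    · exact Integrable.of_bound hh.aestronglyMeasurable C (Eventually.of_forall hhb)
    · exact integrable_const _
  set G : ((Fin q → Bool) → Ω) → X → ℂ := fun ω x => g x * h' (labelBlock T N q ω x) with hG
  have hGm : Measurable (Function.uncurry G) :=
    (hg.comp measurable_snd).mul (hh'm.comp hblk)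
  have hGb : ∀ ω x, ‖G ω x‖ ≤ 2 * C := fun ω x => by
    rw [hG, norm_mul]
    calc ‖g x‖ * ‖h' (labelBlock T N q ω x)‖ ≤ 1 * (2 * C) :=
          mul_le_mul (hgb x) (hh'b _) (norm_nonneg _) zero_le_one
      _ = 2 * C := one_mul _
  have hD : ∀ ω, (∫ x, g x * h (labelBlock T N q ω x) ∂m) - (∫ x, g x ∂m) * c
      = ∫ x, G ω x ∂m := by
    intro ω
    rw [← integral_mul_const, ← integral_sub]
    · refine integral_congr_ae (Eventually.of_forall fun x => ?_)
      simp only [hG, hh']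
      ring
    · refine Integrable.of_bound (hg.mul (hh.comp (hblk.comp
        measurable_prodMk_left))).aestronglyMeasurable (1 * C) (Eventually.of_forall fun x => ?_)
      rw [norm_mul]
      exact mul_le_mul (hgb x) (hhb _) (norm_nonneg _) zero_le_one
    · exact (Integrable.of_bound hg.aestronglyMeasurable 1 (Eventually.of_forall hgb)).mul_const _
  have hconj : Measurable (starRingEnd ℂ) := Complex.continuous_conj.measurable
  set H : ((Fin q → Bool) → Ω) → X × X → ℂ :=
    fun ω p => G ω p.1 * (starRingEnd ℂ) (G ω p.2) with hH
  have hHm : Measurable (Function.uncurry H) :=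
    (hGm.comp (measurable_fst.prodMk (measurable_fst.comp measurable_snd))).mul
      (hconj.comp (hGm.comp (measurable_fst.prodMk (measurable_snd.comp measurable_snd))))
  have hHb : ∀ ω p, ‖H ω p‖ ≤ (2 * C) ^ 2 := fun ω p => by
    rw [hH, norm_mul, RCLike.norm_conj, sq]
    exact mul_le_mul (hGb _ _) (hGb _ _) (norm_nonneg _) (by positivity)
  have hsq : ∀ ω, ((‖∫ x, G ω x ∂m‖ ^ 2 : ℝ) : ℂ) = ∫ p, H ω p ∂m.prod m := by
    intro ω
    rw [hH, integral_prod_mul (fun x => G ω x) (fun y => (starRingEnd ℂ) (G ω y)),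
      integral_conj, RCLike.mul_conj]
    simp
  have hzero : ∀ p, p ∉ collisionSet T N q →
      ∫ ω, H ω p ∂Measure.pi (fun _ => ρ) = 0 := by
    intro p hp
    have hinj := not_not.1 hp
    have := integral_mul_conj_of_injective (ρ := ρ) hinj hh'm
    rw [hh'int, zero_mul] at this
    have e : ∀ ω, H ω p = (g p.1 * (starRingEnd ℂ) (g p.2)) *
        (h' (fun i => ω (cell X q (orbitPair T N p (.inl i)))) *
          (starRingEnd ℂ) (h' (fun i => ω (cell X q (orbitPair T N p (.inr i)))))) := by
      intro ω
      simp only [hH, hG, map_mul, orbitPair, Sum.elim_inl, Sum.elim_inr]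
      unfold labelBlock
      ring
    simp_rw [e]
    rw [integral_const_mul, this, mul_zero]
  -- Exchanging the integrals reduces the mean square to the correlations of the label blocks of
  -- pairs of points, which vanish outside the collision set.
  have hfub : ∫ ω, ∫ p, H ω p ∂m.prod m ∂Measure.pi (fun _ => ρ)
      = ∫ p, ∫ ω, H ω p ∂Measure.pi (fun _ => ρ) ∂m.prod m :=
    integral_integral_swap (Integrable.of_bound hHm.aestronglyMeasurable ((2 * C) ^ 2)
      (Eventually.of_forall fun z => hHb z.1 z.2))
  have hle : ‖∫ p, ∫ ω, H ω p ∂Measure.pi (fun _ => ρ) ∂m.prod m‖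
      ≤ ∫ p, (collisionSet T N q).indicator (fun _ => (2 * C) ^ 2) p ∂m.prod m := by
    refine norm_integral_le_of_norm_le
      ((integrable_const _).indicator (measurableSet_collisionSet hT.measurable N q))
      (Eventually.of_forall fun p => ?_)
    by_cases hp : p ∈ collisionSet T N q
    · rw [Set.indicator_of_mem hp]
      refine (norm_integral_le_of_norm_le_const (Eventually.of_forall fun ω => hHb ω p)).trans ?_
      simp
    · rw [hzero p hp]
      simp [hp]
  rw [integral_indicator_const _ (measurableSet_collisionSet hT.measurable N q), ← hfub,
    smul_eq_mul, mul_comm] at hle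
  simp_rw [hD]
  refine le_trans (le_of_eq ?_) hle
  simp_rw [← hsq]
  rw [integral_complex_ofReal, Complex.norm_real, Real.norm_of_nonneg]
  exact integral_nonneg fun ω => by positivity

/-- **Independent labels.** In an aperiodic system, and for any finite family of bounded
observables, there is a measurable labelling `Z` whose blocks `(Z, Z ∘ T, …, Z ∘ T^(N-1))` are, up
to `ε`, independent identically distributed of law `ρ` and independent of the past observables
`g i`. -/
theorem exists_label [StandardBorelSpace X] [IsProbabilityMeasure m]
    (hT : MeasurePreserving T m m) (hap : IsAperiodic T m) (ρ : Measure Ω)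
    [IsProbabilityMeasure ρ] (N : ℕ) {I : Type*} [Finite I] {g : I → X → ℂ}
    (hg : ∀ i, Measurable (g i)) {h : I → (Fin N → Ω) → ℂ} (hh : ∀ i, Measurable (h i)) {C : ℝ}
    (hgb : ∀ i x, ‖g i x‖ ≤ 1) (hhb : ∀ i v, ‖h i v‖ ≤ C) {ε : ℝ} (hε : 0 < ε) :
    ∃ Z : X → Ω, Measurable Z ∧ ∀ i,
      ‖(∫ x, g i x * h i (fun j => Z (T^[j] x)) ∂m)
        - (∫ x, g i x ∂m) * ∫ v, h i v ∂Measure.pi fun _ => ρ‖ ≤ ε := by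
  cases nonempty_fintype I
  have hlim : Tendsto (fun q => ∑ _i : I,
      (2 * C) ^ 2 * (m.prod m).real (collisionSet (X := X) T N q)) atTop (𝓝 0) := by
    have := (tendsto_measure_collisionSet hT hap N).const_mul ((2 * C) ^ 2)
    have := tendsto_finsetSum (Finset.univ : Finset I) fun _ _ => this
    simpa using this
  obtain ⟨q, hq⟩ := (hlim.eventually_le_const (show (0 : ℝ) < ε ^ 2 by positivity)).exists
  set D : I → ((Fin q → Bool) → Ω) → ℝ := fun i ω =>
    ‖(∫ x, g i x * h i (labelBlock T N q ω x) ∂m)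
        - (∫ x, g i x ∂m) * ∫ v, h i v ∂Measure.pi fun _ => ρ‖ ^ 2 with hD
  have hDm : ∀ i, Measurable (D i) := fun i => by
    have h1 : Measurable (Function.uncurry fun (ω : (Fin q → Bool) → Ω) x =>
        g i x * h i (labelBlock T N q ω x)) :=
      ((hg i).comp measurable_snd).mul ((hh i).comp (measurable_labelBlock hT.measurable N q))
    exact ((h1.stronglyMeasurable.integral_prod_right.measurable.sub_const _).norm).pow_const 2
  have hDint : ∀ i, Integrable (D i) (Measure.pi fun _ => ρ) := fun i => by
    refine Integrable.of_bound (hDm i).aestronglyMeasurable ((1 * C + 1 * C) ^ 2)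
      (Eventually.of_forall fun ω => ?_)
    rw [Real.norm_of_nonneg (by positivity)]
    have b1 : ‖∫ x, g i x * h i (labelBlock T N q ω x) ∂m‖ ≤ 1 * C := by
      refine (norm_integral_le_of_norm_le_const (C := 1 * C)
        (Eventually.of_forall fun x => ?_)).trans (by simp)
      rw [norm_mul]
      exact mul_le_mul (hgb i x) (hhb i _) (norm_nonneg _) zero_le_one
    have b2 : ‖(∫ x, g i x ∂m) * ∫ v, h i v ∂Measure.pi fun _ => ρ‖ ≤ 1 * C := by
      rw [norm_mul]
      refine mul_le_mul ?_ ?_ (norm_nonneg _) zero_le_one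
      · exact (norm_integral_le_of_norm_le_const (Eventually.of_forall (hgb i))).trans (by simp)
      · exact (norm_integral_le_of_norm_le_const (Eventually.of_forall (hhb i))).trans (by simp)
    exact pow_le_pow_left₀ (norm_nonneg _) ((norm_sub_le _ _).trans (add_le_add b1 b2)) 2
  have hsum : ∫ ω, ∑ i, D i ω ∂Measure.pi (fun _ => ρ) ≤ ε ^ 2 := by
    rw [integral_finsetSum _ fun i _ => hDint i]
    exact (Finset.sum_le_sum fun i _ => integral_norm_sq_le_collisionSet hT N q (hg i) (hh i)
      (hgb i) (hhb i)).trans hq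
  -- Some choice of labels does at least as well as the average.
  obtain ⟨ω, hω⟩ := exists_le_integral (integrable_finsetSum Finset.univ fun i _ => hDint i)
  refine ⟨fun x => ω (cell X q x), (measurable_of_finite ω).comp (measurable_cell q), fun i => ?_⟩
  have h1 : D i ω ≤ ε ^ 2 :=
    (Finset.single_le_sum (f := fun i => D i ω) (fun j _ => by positivity)
      (Finset.mem_univ i)).trans (hω.trans hsum)
  exact (pow_le_pow_iff_left₀ (norm_nonneg _) hε.le two_ne_zero).1 h1

end Labels

/-! ### Characteristic functions of random variables -/

section Phase

open Topology

/-- The unitary character `x ↦ exp (i x)` of the real line. -/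
noncomputable def phase (x : ℝ) : ℂ := Complex.exp (x * Complex.I)

theorem norm_phase (x : ℝ) : ‖phase x‖ = 1 := Complex.norm_exp_ofReal_mul_I x

theorem phase_zero : phase 0 = 1 := by simp [phase]

theorem phase_add (x y : ℝ) : phase (x + y) = phase x * phase y := by
  simp [phase, add_mul, Complex.exp_add]

theorem phase_sum {ι : Type*} (s : Finset ι) (u : ι → ℝ) :
    phase (∑ i ∈ s, u i) = ∏ i ∈ s, phase (u i) := by
  classical
  induction s using Finset.induction_on with
  | empty => simp [phase_zero]
  | insert i s hi ih => rw [Finset.sum_insert hi, Finset.prod_insert hi, phase_add, ih]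

theorem continuous_phase : Continuous phase := by unfold phase; fun_prop

theorem measurable_phase : Measurable phase := continuous_phase.measurable

theorem norm_phase_sub_phase_le (x y : ℝ) : ‖phase x - phase y‖ ≤ |x - y| := by
  have h : phase x - phase y = phase y * (Complex.exp (Complex.I * ((x - y : ℝ) : ℂ)) - 1) := by
    have : Complex.exp (Complex.I * ((x - y : ℝ) : ℂ)) = phase (x - y) := by
      rw [phase, mul_comm]
    rw [this, mul_sub, ← phase_add, mul_one]
    congr 2
    ring
  rw [h, norm_mul, norm_phase, one_mul]
  exact Real.norm_exp_I_mul_ofReal_sub_one_le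

variable {Ω : Type*} [MeasurableSpace Ω] {μ : Measure Ω}

/-- The characteristic function of a random variable `Y`. -/
noncomputable def charFn (μ : Measure Ω) (Y : Ω → ℝ) (t : ℝ) : ℂ := ∫ ω, phase (t * Y ω) ∂μ

theorem charFun_map_eq_charFn {Y : Ω → ℝ} (hY : AEMeasurable Y μ) (t : ℝ) :
    charFun (μ.map Y) t = charFn μ Y t := by
  rw [charFun_apply_real, integral_map hY (by fun_prop)]
  simp [charFn, phase]

variable [IsProbabilityMeasure μ]

theorem integrable_phase {Y : Ω → ℝ} (hY : AEMeasurable Y μ) :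
    Integrable (fun ω => phase (Y ω)) μ :=
  Integrable.of_bound (measurable_phase.comp_aemeasurable hY).aestronglyMeasurable 1
    (Eventually.of_forall fun _ => (norm_phase _).le)

theorem continuous_charFn {Y : Ω → ℝ} (hY : AEMeasurable Y μ) : Continuous (charFn μ Y) :=
  continuous_of_dominated (bound := fun _ => 1)
    (fun t => (measurable_phase.comp_aemeasurable (hY.const_mul t)).aestronglyMeasurable)
    (fun _ => Eventually.of_forall fun _ => (norm_phase _).le) (integrable_const _)
    (Eventually.of_forall fun _ => continuous_phase.comp (by fun_prop))

/-- The characteristic function is Lipschitz in the random variable for the `L¹` distance. -/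
theorem norm_charFn_sub_charFn_le {Y Y' : Ω → ℝ} (hY : AEMeasurable Y μ) (hY' : AEMeasurable Y' μ)
    (hi : Integrable (fun ω => Y ω - Y' ω) μ) (t : ℝ) :
    ‖charFn μ Y t - charFn μ Y' t‖ ≤ |t| * ∫ ω, |Y ω - Y' ω| ∂μ := by
  rw [charFn, charFn, ← integral_sub (integrable_phase (hY.const_mul t))
    (integrable_phase (hY'.const_mul t)), ← integral_const_mul]
  refine norm_integral_le_of_norm_le (hi.abs.const_mul _) (Eventually.of_forall fun ω => ?_)
  refine (norm_phase_sub_phase_le _ _).trans (le_of_eq ?_)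
  rw [← mul_sub, abs_mul]

theorem norm_charFn_sub_charFn_le_of_bounded {Y : Ω → ℝ} (hY : AEMeasurable Y μ) {b : ℝ}
    (hb : ∀ ω, |Y ω| ≤ b) (s t : ℝ) :
    ‖charFn μ Y s - charFn μ Y t‖ ≤ |s - t| * b := by
  rw [charFn, charFn, ← integral_sub (integrable_phase (hY.const_mul s))
    (integrable_phase (hY.const_mul t))]
  refine (norm_integral_le_of_norm_le_const (C := |s - t| * b)
    (Eventually.of_forall fun ω => ?_)).trans (by simp)
  refine (norm_phase_sub_phase_le _ _).trans ?_
  rw [← sub_mul, abs_mul]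
  exact mul_le_mul_of_nonneg_left (hb ω) (abs_nonneg _)

end Phase

/-! ### Sums of independent variables -/

section IndependentSums

open ProbabilityTheory

/-- For `n ≤ d`, a product over `range (d + d)` with factors `u j` on the initial segments of
length `n` of the first half, `w j` on the initial segment of length `n` of the second half, and
`1` elsewhere. -/
theorem prod_range_add_self_ite {M : Type*} [CommMonoid M] (u w : ℕ → M) {n d : ℕ} (hn : n ≤ d) :
    ∏ j ∈ Finset.range (d + d), (if j < n then u j else if d ≤ j ∧ j < d + n then w j else 1)
      = (∏ j ∈ Finset.range n, u j) * ∏ j ∈ Finset.range n, w (d + j) := by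
  rw [Finset.prod_range_add]
  congr 1
  · rw [← Finset.prod_subset (Finset.range_subset_range.2 hn)]
    · refine Finset.prod_congr rfl fun j hj => ?_
      rw [if_pos (Finset.mem_range.1 hj)]
    · intro j hj hj'
      rw [Finset.mem_range] at hj hj'
      rw [if_neg hj', if_neg (by omega)]
  · rw [← Finset.prod_subset (Finset.range_subset_range.2 hn)]
    · refine Finset.prod_congr rfl fun j hj => ?_
      rw [Finset.mem_range] at hj
      rw [if_neg (by omega), if_pos (by omega)]
    · intro j hj hj'
      rw [Finset.mem_range] at hj hj'
      rw [if_neg (by omega), if_neg (by omega)]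

variable {ρ : Measure ℝ} [IsProbabilityMeasure ρ] {h : ℝ → ℝ}

/-- The character of the difference `∑ j < n, h (v j) - ∑ j < n, h (v (d + j))` evaluated on a block
`v` of length `d + d`, written as a product over the coordinates. -/
noncomputable def blockPhase (h : ℝ → ℝ) (d n : ℕ) (t : ℝ) (v : Fin (d + d) → ℝ) : ℂ :=
  ∏ j : Fin (d + d), if (j : ℕ) < n then phase (t * h (v j))
    else if d ≤ (j : ℕ) ∧ (j : ℕ) < d + n then phase (-t * h (v j)) else 1

theorem norm_blockPhase (h : ℝ → ℝ) (d n : ℕ) (t : ℝ) (v : Fin (d + d) → ℝ) :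
    ‖blockPhase h d n t v‖ = 1 := by
  rw [blockPhase, norm_prod]
  refine Finset.prod_eq_one fun j _ => ?_
  split_ifs <;> simp [norm_phase]

theorem measurable_blockPhase (hm : Measurable h) (d n : ℕ) (t : ℝ) :
    Measurable (blockPhase h d n t) := by
  unfold blockPhase
  refine Finset.measurable_prod _ fun j _ => ?_
  have := hm.comp (measurable_pi_apply (X := fun _ : Fin (d + d) => ℝ) j)
  split_ifs
  · exact measurable_phase.comp (this.const_mul t)
  · exact measurable_phase.comp (this.const_mul (-t))
  · exact measurable_const

theorem integral_blockPhase {d n : ℕ} (hn : n ≤ d) (t : ℝ) :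
    ∫ v, blockPhase h d n t v ∂Measure.pi (fun _ => ρ)
      = (charFn ρ h t * charFn ρ h (-t)) ^ n := by
  unfold blockPhase
  rw [integral_fintype_prod_eq_prod (f := fun (j : Fin (d + d)) (x : ℝ) =>
    if (j : ℕ) < n then phase (t * h x)
    else if d ≤ (j : ℕ) ∧ (j : ℕ) < d + n then phase (-t * h x) else 1)]
  have h1 : ∀ j : Fin (d + d), ∫ x, (if (j : ℕ) < n then phase (t * h x)
      else if d ≤ (j : ℕ) ∧ (j : ℕ) < d + n then phase (-t * h x) else 1) ∂ρ
      = (fun j : ℕ => if j < n then charFn ρ h t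
        else if d ≤ j ∧ j < d + n then charFn ρ h (-t) else 1) j := by
    intro j
    dsimp only
    split_ifs
    · rfl
    · rfl
    · simp
  simp_rw [h1]
  rw [Fin.prod_univ_eq_prod_range (fun j : ℕ => if j < n then charFn ρ h t
        else if d ≤ j ∧ j < d + n then charFn ρ h (-t) else 1) (d + d),
    prod_range_add_self_ite (fun _ => charFn ρ h t) (fun _ => charFn ρ h (-t)) hn]
  simp [mul_pow]

theorem blockPhase_orbit {X : Type*} {T : X → X} (Z : X → ℝ) {d n : ℕ} (hn : n ≤ d) (t : ℝ)
    (x : X) :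
    blockPhase h d n t (fun j => Z (T^[j] x))
      = phase (t * birkhoffSum T (fun x => h (Z x) - h (Z (T^[d] x))) n x) := by
  have e := Fin.prod_univ_eq_prod_range (fun j : ℕ => if j < n then phase (t * h (Z (T^[j] x)))
        else if d ≤ j ∧ j < d + n then phase (-t * h (Z (T^[j] x))) else 1) (d + d)
  rw [blockPhase, e, prod_range_add_self_ite (fun j => phase (t * h (Z (T^[j] x))))
    (fun j => phase (-t * h (Z (T^[j] x)))) hn, ← phase_sum, ← phase_sum, ← phase_add]
  congr 1
  simp only [birkhoffSum, ← Function.iterate_add_apply, Finset.mul_sum, neg_mul,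
    Finset.sum_neg_distrib, sub_eq_add_neg, mul_add, mul_neg, Finset.sum_add_distrib]

/-- The sum of `h` over the first half of a block of length `d + d`. -/
noncomputable def halfBlockSum (h : ℝ → ℝ) (d : ℕ) (v : Fin (d + d) → ℝ) : ℝ :=
  ∑ j : Fin (d + d), if (j : ℕ) < d then h (v j) else 0

theorem measurable_halfBlockSum (hm : Measurable h) (d : ℕ) : Measurable (halfBlockSum h d) := by
  unfold halfBlockSum
  refine Finset.measurable_sum _ fun j _ => ?_
  have := hm.comp (measurable_pi_apply (X := fun _ : Fin (d + d) => ℝ) j)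
  split_ifs
  · exact this
  · exact measurable_const

theorem abs_halfBlockSum_le {B : ℝ} (hB : ∀ x, |h x| ≤ B) (d : ℕ) (v : Fin (d + d) → ℝ) :
    |halfBlockSum h d v| ≤ (d + d : ℕ) * B := by
  have hB0 : 0 ≤ B := (abs_nonneg _).trans (hB 0)
  refine (Finset.abs_sum_le_sum_abs _ _).trans ?_
  refine (Finset.sum_le_card_nsmul _ _ B fun j _ => ?_).trans (by simp)
  split_ifs
  · exact hB _
  · simpa using hB0

theorem sum_range_add_self_ite {M : Type*} [AddCommMonoid M] (u : ℕ → M) (d : ℕ) :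
    ∑ j ∈ Finset.range (d + d), (if j < d then u j else 0) = ∑ j ∈ Finset.range d, u j := by
  rw [← Finset.sum_filter]
  refine Finset.sum_congr (Finset.ext fun j => ?_) fun _ _ => rfl
  simp only [Finset.mem_filter, Finset.mem_range]
  omega

theorem halfBlockSum_orbit {X : Type*} {T : X → X} (Z : X → ℝ) (d : ℕ) (x : X) :
    halfBlockSum h d (fun j => Z (T^[j] x)) = birkhoffSum T (fun x => h (Z x)) d x := by
  rw [halfBlockSum,
    Fin.sum_univ_eq_sum_range (fun j => if j < d then h (Z (T^[j] x)) else 0) (d + d),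
    sum_range_add_self_ite (fun j => h (Z (T^[j] x)))]
  rfl

theorem integral_abs_le_sqrt_integral_sq {Ω : Type*} [MeasurableSpace Ω] {μ : Measure Ω}
    [IsProbabilityMeasure μ] {Y : Ω → ℝ} (hY : MemLp Y 2 μ) :
    ∫ ω, |Y ω| ∂μ ≤ √(∫ ω, Y ω ^ 2 ∂μ) := by
  refine Real.le_sqrt_of_sq_le ?_
  have h1 := variance_eq_sub hY.abs
  have h2 := variance_nonneg |Y| μ
  simp only [Pi.pow_apply, Pi.abs_apply, sq_abs] at h1
  linarith

theorem integral_abs_halfBlockSum_le (hm : Measurable h) {B : ℝ} (hB : ∀ x, |h x| ≤ B)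
    (hint : ∫ x, h x ∂ρ = 0) (d : ℕ) :
    ∫ v, |halfBlockSum h d v| ∂Measure.pi (fun _ => ρ) ≤ √(d * ∫ x, h x ^ 2 ∂ρ) := by
  have hL : MemLp (halfBlockSum h d) 2 (Measure.pi fun _ : Fin (d + d) => ρ) :=
    MemLp.of_bound (measurable_halfBlockSum hm d).aestronglyMeasurable _
      (Eventually.of_forall fun v => abs_halfBlockSum_le hB d v)
  refine (integral_abs_le_sqrt_integral_sq hL).trans (Real.sqrt_le_sqrt ?_)
  set Y : Fin (d + d) → ℝ → ℝ := fun j x => if (j : ℕ) < d then h x else 0 with hYdef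
  have hYm : ∀ j, Measurable (Y j) := fun j => by
    simp only [hYdef]
    split_ifs
    · exact hm
    · exact measurable_const
  have hYL : ∀ j, MemLp (Y j) 2 ρ := fun j => by
    refine MemLp.of_bound (hYm j).aestronglyMeasurable B (Eventually.of_forall fun x => ?_)
    simp only [hYdef]
    split_ifs
    · exact hB x
    · simpa using (abs_nonneg _).trans (hB 0)
  have hYi : ∀ j, ∫ x, Y j x ∂ρ = 0 := fun j => by
    simp only [hYdef]
    split_ifs
    · exact hint
    · simp
  have hS : halfBlockSum h d = ∑ j, fun v : Fin (d + d) → ℝ => Y j (v j) := by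
    ext v
    simp [halfBlockSum, hYdef]
  have hSi : ∫ v, halfBlockSum h d v ∂Measure.pi (fun _ => ρ) = 0 := by
    rw [hS]
    simp only [Finset.sum_apply]
    rw [integral_finsetSum]
    · refine Finset.sum_eq_zero fun j _ => ?_
      rw [integral_comp_eval (μ := fun _ => ρ) (hYm j).aestronglyMeasurable, hYi]
    · exact fun j _ => (measurePreserving_eval (fun _ => ρ) j).integrable_comp_of_integrable
        ((hYL j).integrable one_le_two)
  rw [← variance_of_integral_eq_zero hL.aestronglyMeasurable.aemeasurable hSi, hS,
    variance_sum_pi hYL]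
  have hle : ∀ j : Fin (d + d), variance (Y j) ρ
      ≤ (fun j : ℕ => if j < d then ∫ x, h x ^ 2 ∂ρ else 0) j := fun j => by
    refine (variance_le_expectation_sq (hYm j).aestronglyMeasurable).trans (le_of_eq ?_)
    simp only [hYdef, Pi.pow_apply]
    split_ifs
    · rfl
    · simp
  refine (Finset.sum_le_sum fun j _ => hle j).trans (le_of_eq ?_)
  rw [Fin.sum_univ_eq_sum_range (fun j : ℕ => if j < d then ∫ x, h x ^ 2 ∂ρ else 0) (d + d),
    sum_range_add_self_ite (fun _ => ∫ x, h x ^ 2 ∂ρ)]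
  simp

end IndependentSums

/-! ### One component of the observable -/

section Stage

open Topology

variable {X : Type*} {T : X → X}

theorem measurable_birkhoffSum [MeasurableSpace X] (hT : Measurable T) {F : X → ℝ}
    (hF : Measurable F) (n : ℕ) : Measurable (birkhoffSum T F n) := by
  have : birkhoffSum T F n = fun x => ∑ k ∈ Finset.range n, F (T^[k] x) := rfl
  rw [this]
  exact Finset.measurable_sum _ fun k _ => hF.comp (hT.iterate k)

theorem abs_birkhoffSum_le {F : X → ℝ} {b : ℝ} (hb : ∀ x, |F x| ≤ b) (n : ℕ) (x : X) :
    |birkhoffSum T F n x| ≤ n * b := by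
  refine (Finset.abs_sum_le_sum_abs _ _).trans ?_
  refine (Finset.sum_le_card_nsmul _ _ b fun j _ => hb _).trans (by simp)

theorem birkhoffSum_add_apply (F G : X → ℝ) (n : ℕ) (x : X) :
    birkhoffSum T (fun x => F x + G x) n x = birkhoffSum T F n x + birkhoffSum T G n x :=
  Finset.sum_add_distrib

variable [MeasurableSpace X] [StandardBorelSpace X] {m : Measure X} [IsProbabilityMeasure m]

/-- Given finitely many bounded observables `F i`, there is an observable `W`, nearly distributed
as `h` under `ρ`, such that for `n ≤ d` the Birkhoff sums of the coboundary `W - W ∘ T^d` are nearly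
independent of those of `F i` and nearly distributed as differences of two sums of `n` independent
copies of `h`. -/
theorem exists_component (hT : MeasurePreserving T m m) (hap : IsAperiodic T m) (ρ : Measure ℝ)
    [IsProbabilityMeasure ρ] {h : ℝ → ℝ} (hm : Measurable h) {B : ℝ} (hB : ∀ x, |h x| ≤ B)
    (hint : ∫ x, h x ∂ρ = 0) {d : ℕ} (hd : 0 < d) (M : ℝ) {I : Type*} [Finite I]
    {F : I → X → ℝ} (hF : ∀ i, Measurable (F i)) {b : ℝ} (hFb : ∀ i x, |F i x| ≤ b)
    {ε : ℝ} (hε : 0 < ε) :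
    ∃ W : X → ℝ, Measurable W ∧ (∀ x, |W x| ≤ B) ∧
      (∀ i, ∀ n ≤ d, ∀ t, |t| ≤ M →
        ‖charFn m (birkhoffSum T (fun x => F i x + (W x - W (T^[d] x))) n) t
          - charFn m (birkhoffSum T (F i) n) t * (charFn ρ h t * charFn ρ h (-t)) ^ n‖ ≤ ε) ∧
      ∫ x, |birkhoffSum T W d x| ∂m ≤ √(d * ∫ x, h x ^ 2 ∂ρ) + ε ∧
      m.real {x | W x ≠ 0} ≤ ρ.real {x | h x ≠ 0} + ε := by
  have hB0 : 0 ≤ B := (abs_nonneg _).trans (hB 0)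
  have hFb' : ∀ i x, |F i x| ≤ |b| := fun i x => (hFb i x).trans (le_abs_self b)
  -- A finite net of frequencies controls all `|t| ≤ M`: the limit expression is continuous, and the
  -- characteristic function of the Birkhoff sum is Lipschitz uniformly in the choice of `W`.
  set L : ℝ := d * (|b| + 2 * B) + 1 with hL
  have hLpos : 0 < L := by positivity
  set P : I → Fin (d + 1) → ℝ → ℂ := fun i n t =>
    charFn m (birkhoffSum T (F i) n) t * (charFn ρ h t * charFn ρ h (-t)) ^ (n : ℕ) with hP
  have hPc : ∀ i n, Continuous (P i n) := fun i n => by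
    have h1 := continuous_charFn (μ := m)
      (measurable_birkhoffSum hT.measurable (hF i) n).aemeasurable
    have h2 := continuous_charFn (μ := ρ) hm.aemeasurable
    exact h1.mul ((h2.mul (h2.comp continuous_neg)).pow _)
  set U : ℝ → Set ℝ := fun s =>
    {t | |t - s| < ε / 3 / L ∧ ∀ i n, ‖P i n t - P i n s‖ < ε / 3} with hU
  have hUn : ∀ s ∈ Set.Icc (-M) M, U s ∈ 𝓝 s := fun s _ => by
    have h1 : ∀ᶠ t in 𝓝 s, |t - s| < ε / 3 / L := by
      have := Metric.ball_mem_nhds s (show 0 < ε / 3 / L by positivity)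
      filter_upwards [this] with t ht
      rwa [Metric.mem_ball, Real.dist_eq] at ht
    have h2 : ∀ᶠ t in 𝓝 s, ∀ i n, ‖P i n t - P i n s‖ < ε / 3 := by
      simp only [eventually_all]
      intro i n
      have := (hPc i n).continuousAt (x := s) (Metric.ball_mem_nhds _ (show 0 < ε / 3 by positivity))
      filter_upwards [this] with t ht
      rwa [Set.mem_preimage, Metric.mem_ball, dist_eq_norm] at ht
    exact h1.and h2
  obtain ⟨net, -, hnet⟩ := isCompact_Icc.elim_nhds_subcover U hUn
  set z0 : Fin (d + d) := ⟨0, by omega⟩ with hz0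
  have hsupp : MeasurableSet {x | h x ≠ 0} := (hm (measurableSet_singleton 0)).compl
  set C : ℝ := (d + d : ℕ) * B + 1 with hC
  have hC1 : 1 ≤ C := by rw [hC]; exact le_add_of_nonneg_left (by positivity)
  -- The observables tested: characters at the net points, `|S_d W|`, and the event `W ≠ 0`.
  set g : (I × Fin (d + 1) × net) ⊕ Bool → X → ℂ := Sum.elim
    (fun k x => phase (k.2.2 * birkhoffSum T (F k.1) k.2.1 x)) (fun _ _ => 1) with hg
  set φ : (I × Fin (d + 1) × net) ⊕ Bool → (Fin (d + d) → ℝ) → ℂ := Sum.elim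
    (fun k => blockPhase h d k.2.1 k.2.2)
    (fun c v => if c then ((|halfBlockSum h d v| : ℝ) : ℂ)
      else ((({x | h x ≠ 0}.indicator (fun _ => 1) (v z0) : ℝ)) : ℂ)) with hφ
  obtain ⟨Z, hZm, hZ⟩ := exists_label hT hap ρ (d + d) (g := g) (h := φ) (C := C) (ε := ε / 3)
    (by
      rintro (k | c)
      · exact measurable_phase.comp
          ((measurable_birkhoffSum hT.measurable (hF k.1) _).const_mul _)
      · exact measurable_const)
    (by
      rintro (k | _ | _)
      · exact measurable_blockPhase hm _ _ _
      · simp only [hφ, Sum.elim_inr, Bool.false_eq_true, if_false]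
        exact Complex.measurable_ofReal.comp
          ((measurable_const.indicator hsupp).comp (measurable_pi_apply z0))
      · simp only [hφ, Sum.elim_inr, if_true]
        exact Complex.measurable_ofReal.comp
          (continuous_abs.measurable.comp (measurable_halfBlockSum hm d)))
    (by
      rintro (k | c) x
      · exact (norm_phase _).le
      · simp [hg])
    (by
      rintro (k | _ | _) v
      · exact (norm_blockPhase _ _ _ _ _).le.trans hC1
      · simp only [hφ, Sum.elim_inr, Bool.false_eq_true, if_false, Complex.norm_real]
        refine le_trans ?_ hC1
        by_cases hv : h (v z0) = 0 <;> simp [hv]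
      · simp only [hφ, Sum.elim_inr, if_true, Complex.norm_real, Real.norm_eq_abs, abs_abs]
        exact (abs_halfBlockSum_le hB d v).trans (by simp [hC]))
    (by positivity)
  have hWm : Measurable fun x => h (Z x) := hm.comp hZm
  refine ⟨fun x => h (Z x), hWm, fun x => hB _, fun i n hn t ht => ?_, ?_, ?_⟩
  · obtain ⟨s, hs, hts, hPs⟩ : ∃ s ∈ net, |t - s| < ε / 3 / L ∧
        ∀ i n, ‖P i n t - P i n s‖ < ε / 3 := by
      obtain ⟨s, hs, hts⟩ := Set.mem_iUnion₂.1 (hnet (abs_le.1 ht))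
      exact ⟨s, hs, hts⟩
    set f : X → ℝ := fun x => F i x + (h (Z x) - h (Z (T^[d] x))) with hf
    have hfm : Measurable f :=
      (hF i).add (hWm.sub (hWm.comp (hT.measurable.iterate d)))
    have hfb : ∀ x, |f x| ≤ |b| + 2 * B := fun x => by
      refine (abs_add_le _ _).trans (add_le_add (hFb' i x) ((abs_sub _ _).trans ?_))
      linarith [hB (Z x), hB (Z (T^[d] x))]
    have h1 : ‖charFn m (birkhoffSum T f n) t - charFn m (birkhoffSum T f n) s‖ ≤ ε / 3 := by
      refine (norm_charFn_sub_charFn_le_of_bounded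
        (measurable_birkhoffSum hT.measurable hfm n).aemeasurable
        (abs_birkhoffSum_le hfb n) t s).trans ?_
      have hnL : (n : ℝ) * (|b| + 2 * B) ≤ L := by
        have : (n : ℝ) ≤ d := by exact_mod_cast hn
        have := mul_le_mul_of_nonneg_right this (show 0 ≤ |b| + 2 * B by positivity)
        linarith
      calc |t - s| * (n * (|b| + 2 * B)) ≤ ε / 3 / L * L :=
            mul_le_mul hts.le hnL (by positivity) (by positivity)
        _ = ε / 3 := div_mul_cancel₀ _ hLpos.ne'
    have h2 := hZ (.inl (i, ⟨n, Nat.lt_succ_of_le hn⟩, ⟨s, hs⟩))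
    have e1 : (∫ x, g (.inl (i, ⟨n, Nat.lt_succ_of_le hn⟩, ⟨s, hs⟩)) x *
        φ (.inl (i, ⟨n, Nat.lt_succ_of_le hn⟩, ⟨s, hs⟩)) (fun j => Z (T^[j] x)) ∂m)
        = charFn m (birkhoffSum T f n) s := by
      refine integral_congr_ae (Eventually.of_forall fun x => ?_)
      simp only [hg, hφ, Sum.elim_inl]
      rw [blockPhase_orbit Z hn, ← phase_add, ← mul_add, hf, birkhoffSum_add_apply]
    have e2 : (∫ v, φ (.inl (i, ⟨n, Nat.lt_succ_of_le hn⟩, ⟨s, hs⟩)) v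
        ∂Measure.pi fun _ => ρ) = (charFn ρ h s * charFn ρ h (-s)) ^ n :=
      integral_blockPhase hn s
    rw [e1, e2] at h2
    have h3 := (hPs i ⟨n, Nat.lt_succ_of_le hn⟩).le
    calc ‖charFn m (birkhoffSum T f n) t - P i ⟨n, Nat.lt_succ_of_le hn⟩ t‖
        = ‖(charFn m (birkhoffSum T f n) t - charFn m (birkhoffSum T f n) s)
          + (charFn m (birkhoffSum T f n) s - P i ⟨n, Nat.lt_succ_of_le hn⟩ s)
          - (P i ⟨n, Nat.lt_succ_of_le hn⟩ t - P i ⟨n, Nat.lt_succ_of_le hn⟩ s)‖ := by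
            congr 1
            ring
      _ ≤ ε / 3 + ε / 3 + ε / 3 :=
        (norm_sub_le _ _).trans (add_le_add ((norm_add_le _ _).trans (add_le_add h1 h2)) h3)
      _ = ε := by ring
  · have h2 := hZ (.inr true)
    simp only [hg, hφ, Sum.elim_inr, if_true, one_mul, integral_const, probReal_univ,
      one_smul, halfBlockSum_orbit, integral_complex_ofReal] at h2
    rw [← Complex.ofReal_sub, Complex.norm_real, Real.norm_eq_abs] at h2
    have h3 := integral_abs_halfBlockSum_le (ρ := ρ) hm hB hint d
    have h4 := (abs_le.1 h2).2
    linarith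
  · have h2 := hZ (.inr false)
    simp only [hg, hφ, Sum.elim_inr, Bool.false_eq_true, if_false, one_mul, integral_const,
      probReal_univ, one_smul, integral_complex_ofReal] at h2
    rw [← Complex.ofReal_sub, Complex.norm_real, Real.norm_eq_abs,
      integral_comp_eval (μ := fun _ => ρ) (i := z0)
        (f := fun y => {x | h x ≠ 0}.indicator (fun _ => (1 : ℝ)) y)
        (measurable_const.indicator hsupp).aestronglyMeasurable] at h2
    have e1 : (∫ x, {x | h x ≠ 0}.indicator (fun _ => (1 : ℝ)) (Z (T^[(z0 : ℕ)] x)) ∂m)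
        = m.real {x | h (Z x) ≠ 0} := by
      have : (fun x => {x | h x ≠ 0}.indicator (fun _ => (1 : ℝ)) (Z (T^[(z0 : ℕ)] x)))
          = {x | h (Z x) ≠ 0}.indicator (fun _ => (1 : ℝ)) := by
        ext x
        rfl
      have hsuppZ : MeasurableSet {x | h (Z x) ≠ 0} := hZm hsupp
      rw [this, integral_indicator_const _ hsuppZ, smul_eq_mul, mul_one]
    rw [e1, integral_indicator_const _ hsupp, smul_eq_mul, mul_one] at h2
    have h4 := (abs_le.1 h2).2
    linarith

end Stage

/-! ### The sequence of components -/

section Components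

/-- Dependent choice along `ℕ`, where the condition on the `k`-th term involves all earlier ones. -/
theorem exists_seq_forall_prefix {A : Type*} [Nonempty A] {Q : ℕ → (ℕ → A) → A → Prop}
    (hQ : ∀ k v v' a, (∀ i < k, v i = v' i) → Q k v a → Q k v' a)
    (step : ∀ k v, ∃ a, Q k v a) : ∃ u : ℕ → A, ∀ k, Q k u (u k) := by
  classical
  choose next hnext using step
  let u : ℕ → A := fun k => Nat.strongRecOn k fun k rec =>
    next k fun i => if hi : i < k then rec i hi else Classical.arbitrary A
  have hu : ∀ k, u k = next k fun i => if i < k then u i else Classical.arbitrary A := by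
    intro k
    simp only [u]
    rw [Nat.strongRecOn_eq]
    simp
  refine ⟨u, fun k => ?_⟩
  have h := hnext k fun i => if i < k then u i else Classical.arbitrary A
  rw [← hu] at h
  exact hQ k _ _ _ (fun i hi => if_pos hi) h

variable {X : Type*} {T : X → X}

/-- The sum of the coboundaries `W i - W i ∘ T^(d i)` over `K ≤ i < L`. -/
noncomputable def coboundarySum (T : X → X) (W : ℕ → X → ℝ) (d : ℕ → ℕ) (K L : ℕ) (x : X) : ℝ :=
  ∑ i ∈ Finset.Ico K L, (W i x - W i (T^[d i] x))

theorem coboundarySum_succ (W : ℕ → X → ℝ) (d : ℕ → ℕ) {K L : ℕ} (h : K ≤ L) (x : X) :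
    coboundarySum T W d K (L + 1) x
      = coboundarySum T W d K L x + (W L x - W L (T^[d L] x)) :=
  Finset.sum_Ico_succ_top h _

theorem measurable_coboundarySum [MeasurableSpace X] (hT : Measurable T) {W : ℕ → X → ℝ}
    (hW : ∀ k, Measurable (W k)) (d : ℕ → ℕ) (K L : ℕ) :
    Measurable (coboundarySum T W d K L) := by
  have : coboundarySum T W d K L
      = fun x => ∑ i ∈ Finset.Ico K L, (W i x - W i (T^[d i] x)) := rfl
  rw [this]
  exact Finset.measurable_sum _ fun i _ => (hW i).sub ((hW i).comp (hT.iterate (d i)))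

theorem abs_coboundarySum_le {W : ℕ → X → ℝ} {b : ℕ → ℝ} (hW : ∀ k x, |W k x| ≤ b k) (d : ℕ → ℕ)
    (K L : ℕ) (x : X) : |coboundarySum T W d K L x| ≤ ∑ i ∈ Finset.Ico K L, 2 * b i := by
  refine (Finset.abs_sum_le_sum_abs _ _).trans (Finset.sum_le_sum fun i _ => ?_)
  refine (abs_sub _ _).trans ?_
  linarith [hW i x, hW i (T^[d i] x)]

variable [MeasurableSpace X] [StandardBorelSpace X] {m : Measure X} [IsProbabilityMeasure m]

/-- A sequence of components `W k`, each chosen by `exists_component` against all the sums of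
consecutive earlier coboundaries. The bound holds for times `n ≤ d k` and frequencies `|t| ≤ k`. -/
theorem exists_components (hT : MeasurePreserving T m m) (hap : IsAperiodic T m) (ρ : Measure ℝ)
    [IsProbabilityMeasure ρ] {h : ℕ → ℝ → ℝ} (hm : ∀ k, Measurable (h k)) {B : ℕ → ℝ}
    (hB : ∀ k x, |h k x| ≤ B k) (hint : ∀ k, ∫ x, h k x ∂ρ = 0) {d : ℕ → ℕ} (hd : ∀ k, 0 < d k)
    {ε : ℕ → ℝ} (hε : ∀ k, 0 < ε k) :
    ∃ W : ℕ → X → ℝ, (∀ k, Measurable (W k)) ∧ (∀ k x, |W k x| ≤ B k) ∧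
      (∀ k, ∀ K ≤ k, ∀ n ≤ d k, ∀ t, |t| ≤ (k : ℝ) →
        ‖charFn m (birkhoffSum T (coboundarySum T W d K (k + 1)) n) t
          - charFn m (birkhoffSum T (coboundarySum T W d K k) n) t
            * (charFn ρ (h k) t * charFn ρ (h k) (-t)) ^ n‖ ≤ ε k) ∧
      (∀ k, ∫ x, |birkhoffSum T (W k) (d k) x| ∂m ≤ √(d k * ∫ x, h k x ^ 2 ∂ρ) + ε k) ∧
      ∀ k, m.real {x | W k x ≠ 0} ≤ ρ.real {x | h k x ≠ 0} + ε k := by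
  -- Bounded measurable functions, so that every prefix of a sequence of them is admissible.
  let A := {W : X → ℝ // Measurable W ∧ ∃ b, ∀ x, |W x| ≤ b}
  have : Nonempty A := ⟨⟨fun _ => 0, measurable_const, 0, by simp⟩⟩
  let Q : ℕ → (ℕ → A) → A → Prop := fun k v a =>
    (∀ x, |a.1 x| ≤ B k) ∧
    (∀ K ≤ k, ∀ n ≤ d k, ∀ t, |t| ≤ (k : ℝ) →
        ‖charFn m (birkhoffSum T (fun x => coboundarySum T (fun i => (v i).1) d K k x
            + (a.1 x - a.1 (T^[d k] x))) n) t
          - charFn m (birkhoffSum T (coboundarySum T (fun i => (v i).1) d K k) n) t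
            * (charFn ρ (h k) t * charFn ρ (h k) (-t)) ^ n‖ ≤ ε k) ∧
    ∫ x, |birkhoffSum T a.1 (d k) x| ∂m ≤ √(d k * ∫ x, h k x ^ 2 ∂ρ) + ε k ∧
    m.real {x | a.1 x ≠ 0} ≤ ρ.real {x | h k x ≠ 0} + ε k
  obtain ⟨u, hu⟩ : ∃ u : ℕ → A, ∀ k, Q k u (u k) := by
    refine exists_seq_forall_prefix (fun k v v' a hv => ?_) fun k v => ?_
    · have e : ∀ K, coboundarySum T (fun i => (v i).1) d K k
          = coboundarySum T (fun i => (v' i).1) d K k := fun K => by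
        ext x
        refine Finset.sum_congr rfl fun i hi => ?_
        dsimp only
        rw [hv i (Finset.mem_Ico.1 hi).2]
      simp only [Q, e, imp_self]
    · choose b hb using fun i => (v i).2.2
      have hb0 : ∀ i, 0 ≤ b i := fun i =>
        (abs_nonneg _).trans (hb i (Classical.choice (nonempty_of_isProbabilityMeasure m)))
      obtain ⟨W, hWm, hWB, h1, h2, h3⟩ := exists_component hT hap ρ (hm k) (hB k) (hint k) (hd k)
        (k : ℝ) (I := Fin (k + 1))
        (F := fun K => coboundarySum T (fun i => (v i).1) d K k)
        (fun K => measurable_coboundarySum hT.measurable (fun i => (v i).2.1) d K k)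
        (b := ∑ i ∈ Finset.range k, 2 * b i)
        (fun K x => (abs_coboundarySum_le hb d K k x).trans
          (Finset.sum_le_sum_of_subset_of_nonneg
            (fun i hi => Finset.mem_range.2 (Finset.mem_Ico.1 hi).2)
            fun i _ _ => mul_nonneg zero_le_two (hb0 i))) (hε k)
      exact ⟨⟨W, hWm, B k, hWB⟩, hWB, fun K hK => h1 ⟨K, Nat.lt_succ_of_le hK⟩, h2, h3⟩
  refine ⟨fun k => (u k).1, fun k => (u k).2.1, fun k => (hu k).1, fun k K hK n hn t ht => ?_,
    fun k => (hu k).2.2.1, fun k => (hu k).2.2.2⟩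
  have h1 := (hu k).2.1 K hK n hn t ht
  have e : coboundarySum T (fun i => (u i).1) d K (k + 1) = fun x =>
      coboundarySum T (fun i => (u i).1) d K k x + ((u k).1 x - (u k).1 (T^[d k] x)) := by
    ext x
    exact coboundarySum_succ _ d hK x
  rw [e]
  exact h1

end Components

/-! ### The symmetric Pareto law -/

section Pareto

open Topology

/-- The density of the symmetric Pareto law as a function of the absolute value: half of the
Pareto density. -/
noncomputable def halfParetoDensity (α r : ℝ) : ℝ := if 1 < r then α / 2 * r ^ (-1 - α) else 0

/-- The symmetric Pareto law of exponent `α`, with density `(α / 2) * |x| ^ (-1 - α)` on `1 < |x|`. -/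
noncomputable def symmPareto (α : ℝ) : Measure ℝ :=
  volume.withDensity fun x => ENNReal.ofReal (halfParetoDensity α |x|)

variable {α : ℝ}

theorem halfParetoDensity_nonneg (hα : 0 < α) (r : ℝ) : 0 ≤ halfParetoDensity α r := by
  unfold halfParetoDensity
  split_ifs with h
  · have : 0 < r := by linarith
    positivity
  · exact le_rfl

theorem measurable_halfParetoDensity (α : ℝ) : Measurable (halfParetoDensity α) := by
  unfold halfParetoDensity
  exact Measurable.ite measurableSet_Ioi (by fun_prop) measurable_const

theorem integral_symmPareto {E : Type*} [NormedAddCommGroup E] [NormedSpace ℝ E] (hα : 0 < α)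
    (F : ℝ → E) : ∫ x, F x ∂symmPareto α = ∫ x, halfParetoDensity α |x| • F x := by
  rw [symmPareto, integral_withDensity_eq_integral_toReal_smul]
  · simp_rw [ENNReal.toReal_ofReal (halfParetoDensity_nonneg hα _)]
  · exact ((measurable_halfParetoDensity α).comp continuous_abs.measurable).ennreal_ofReal
  · exact Eventually.of_forall fun _ => ENNReal.ofReal_lt_top

theorem integral_halfParetoDensity_mul_comp_abs (α : ℝ) (G : ℝ → ℝ) :
    ∫ x, halfParetoDensity α |x| * G |x| = ∫ x in Set.Ioi 1, G x * (α * x ^ (-1 - α)) := by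
  rw [integral_comp_abs (f := fun r => halfParetoDensity α r * G r)]
  have h : (fun x => halfParetoDensity α x * G x)
      = (Set.Ioi 1).indicator fun x => (1 / 2) * (G x * (α * x ^ (-1 - α))) := by
    ext x
    by_cases hx : 1 < x
    · rw [Set.indicator_of_mem (Set.mem_Ioi.2 hx), halfParetoDensity, if_pos hx]
      ring
    · rw [Set.indicator_of_notMem (by simpa using hx), halfParetoDensity, if_neg hx, zero_mul]
  rw [h, setIntegral_indicator measurableSet_Ioi, Set.inter_eq_right.2
    (Set.Ioi_subset_Ioi zero_le_one), integral_const_mul]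
  ring

theorem integral_symmPareto_comp_abs (hα : 0 < α) (G : ℝ → ℝ) :
    ∫ x, G |x| ∂symmPareto α = ∫ x in Set.Ioi 1, G x * (α * x ^ (-1 - α)) := by
  rw [integral_symmPareto hα]
  exact integral_halfParetoDensity_mul_comp_abs α G

theorem integral_Ioi_paretoDensity (hα : 0 < α) {a : ℝ} (ha : 0 < a) :
    ∫ x in Set.Ioi a, α * x ^ (-1 - α) = a ^ (-α) := by
  rw [integral_const_mul, integral_Ioi_rpow_of_lt (by linarith) ha]
  have : -1 - α + 1 = -α := by ring
  rw [this]
  field_simp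

theorem isProbabilityMeasure_symmPareto (hα : 0 < α) : IsProbabilityMeasure (symmPareto α) := by
  have h1 : ∫ x, halfParetoDensity α |x| = 1 := by
    have := integral_halfParetoDensity_mul_comp_abs α fun _ => 1
    simp only [mul_one, one_mul] at this
    rw [this, integral_Ioi_paretoDensity hα one_pos, Real.one_rpow]
  have hi : Integrable fun x => halfParetoDensity α |x| := by
    by_contra h
    rw [integral_undef h] at h1
    exact zero_ne_one h1
  refine ⟨?_⟩
  rw [symmPareto, withDensity_apply _ MeasurableSet.univ, Measure.restrict_univ,
    ← ofReal_integral_eq_lintegral_ofReal hi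
      (Eventually.of_forall fun _ => halfParetoDensity_nonneg hα _), h1, ENNReal.ofReal_one]

theorem integral_symmPareto_eq_zero_of_odd (hα : 0 < α) {F : ℝ → ℝ} (hF : ∀ x, F (-x) = -F x) :
    ∫ x, F x ∂symmPareto α = 0 := by
  rw [integral_symmPareto hα]
  have h := integral_neg_eq_self (fun x => halfParetoDensity α |x| • F x) volume
  simp only [abs_neg, hF, smul_neg, integral_neg] at h
  linarith

theorem symmPareto_real_abs_gt (hα : 0 < α) {a : ℝ} (ha : 1 ≤ a) :
    (symmPareto α).real {x | a < |x|} = a ^ (-α) := by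
  have hs : MeasurableSet {x : ℝ | a < |x|} := measurableSet_lt measurable_const (by fun_prop)
  have h := integral_symmPareto_comp_abs hα ((Set.Ioi a).indicator fun _ => 1)
  have e : (fun x : ℝ => (Set.Ioi a).indicator (fun _ => (1 : ℝ)) |x|)
      = {x : ℝ | a < |x|}.indicator fun _ => 1 := rfl
  rw [e, integral_indicator_const _ hs, smul_eq_mul, mul_one] at h
  rw [h, ← integral_Ioi_paretoDensity hα (by linarith : 0 < a)]
  have e2 : (fun x : ℝ => (Set.Ioi a).indicator (fun _ => (1 : ℝ)) x * (α * x ^ (-1 - α)))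
      = (Set.Ioi a).indicator fun x => α * x ^ (-1 - α) := by
    ext x
    by_cases hx : x ∈ Set.Ioi a <;> simp [hx]
  rw [e2, setIntegral_indicator measurableSet_Ioi,
    Set.inter_eq_right.2 (Set.Ioi_subset_Ioi ha)]

/-- The identity, truncated to the layer `a < |x| ≤ b`. -/
noncomputable def layer (a b x : ℝ) : ℝ := if a < |x| ∧ |x| ≤ b then x else 0

theorem measurable_layer (a b : ℝ) : Measurable (layer a b) :=
  Measurable.ite (measurableSet_Ioc.preimage continuous_abs.measurable) measurable_id
    measurable_const

theorem layer_neg (a b x : ℝ) : layer a b (-x) = -layer a b x := by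
  unfold layer
  rw [abs_neg]
  split_ifs <;> simp

theorem abs_layer_le {a b : ℝ} (hb : 0 ≤ b) (x : ℝ) : |layer a b x| ≤ b := by
  unfold layer
  split_ifs with h
  · exact h.2
  · simpa using hb

theorem symmPareto_real_layer_ne_zero_le (hα : 0 < α) {a : ℝ} (ha : 1 ≤ a) (b : ℝ) :
    (symmPareto α).real {x | layer a b x ≠ 0} ≤ a ^ (-α) := by
  have := isProbabilityMeasure_symmPareto hα
  rw [← symmPareto_real_abs_gt hα ha]
  refine measureReal_mono fun x hx => ?_
  by_contra h
  exact hx (if_neg fun h' => h h'.1)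

theorem integral_layer_sq_le (hα : 0 < α) {a b : ℝ} (ha : 1 ≤ a) :
    ∫ x, layer a b x ^ 2 ∂symmPareto α ≤ b ^ 2 * a ^ (-α) := by
  have := isProbabilityMeasure_symmPareto hα
  have hs : MeasurableSet {x : ℝ | a < |x|} := measurableSet_lt measurable_const (by fun_prop)
  rw [← symmPareto_real_abs_gt hα ha, mul_comm, ← smul_eq_mul, ← integral_indicator_const _ hs]
  refine integral_mono_of_nonneg (Eventually.of_forall fun x => sq_nonneg _)
    ((integrable_const _).indicator hs) (Eventually.of_forall fun x => ?_)
  dsimp only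
  unfold layer
  split_ifs with h
  · rw [Set.indicator_of_mem (show x ∈ {x : ℝ | a < |x|} from h.1), ← sq_abs x]
    exact pow_le_pow_left₀ (abs_nonneg _) h.2 2
  · rw [zero_pow two_ne_zero]
    exact Set.indicator_nonneg (fun _ _ => sq_nonneg b) _

/-- The integral of `1 - cos (t x)` against the Lévy density `α x ^ (-1 - α)` over `a < x ≤ b`. -/
noncomputable def levyExponent (α a b t : ℝ) : ℝ :=
  ∫ x in a..b, (1 - Real.cos (t * x)) * (α * x ^ (-1 - α))

theorem intervalIntegrable_levy (α t : ℝ) {a b : ℝ} (ha : 0 < a) (hb : 0 < b) :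
    IntervalIntegrable (fun x => (1 - Real.cos (t * x)) * (α * x ^ (-1 - α))) volume a b := by
  refine ContinuousOn.intervalIntegrable fun x hx => ContinuousAt.continuousWithinAt ?_
  have hx0 : x ≠ 0 := by
    have := (Set.mem_uIcc.1 hx)
    rcases this with h | h
    · exact (lt_of_lt_of_le ha h.1).ne'
    · exact (lt_of_lt_of_le hb h.1).ne'
  have := Real.continuousAt_rpow_const x (-1 - α) (Or.inl hx0)
  fun_prop

/-- By symmetry the characteristic function of a layer is real. -/
theorem charFn_layer (hα : 0 < α) {a b : ℝ} (ha : 1 ≤ a) (hab : a ≤ b) (t : ℝ) :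
    charFn (symmPareto α) (layer a b) t = ((1 - levyExponent α a b t : ℝ) : ℂ) := by
  have := isProbabilityMeasure_symmPareto hα
  have hlm := (measurable_layer a b).const_mul t
  have hcos : Integrable (fun x => Real.cos (t * layer a b x)) (symmPareto α) :=
    Integrable.of_bound (Real.measurable_cos.comp hlm).aestronglyMeasurable 1
      (Eventually.of_forall fun x => Real.abs_cos_le_one _)
  have hsin : Integrable (fun x => Real.sin (t * layer a b x)) (symmPareto α) :=
    Integrable.of_bound (Real.measurable_sin.comp hlm).aestronglyMeasurable 1
      (Eventually.of_forall fun x => Real.abs_sin_le_one _)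
  have h1 : charFn (symmPareto α) (layer a b) t
      = ((∫ x, Real.cos (t * layer a b x) ∂symmPareto α : ℝ) : ℂ)
        + ((∫ x, Real.sin (t * layer a b x) ∂symmPareto α : ℝ) : ℂ) * Complex.I := by
    rw [← integral_complex_ofReal, ← integral_complex_ofReal, ← integral_mul_const,
      ← integral_add hcos.ofReal (hsin.ofReal.mul_const _)]
    refine integral_congr_ae (Eventually.of_forall fun x => ?_)
    simp only [phase, Complex.exp_mul_I, ← Complex.ofReal_cos, ← Complex.ofReal_sin]
  have h2 : ∫ x, Real.sin (t * layer a b x) ∂symmPareto α = 0 :=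
    integral_symmPareto_eq_zero_of_odd hα fun x => by rw [layer_neg, mul_neg, Real.sin_neg]
  have h3 : ∫ x, (1 - Real.cos (t * layer a b x)) ∂symmPareto α = levyExponent α a b t := by
    have e : (fun x : ℝ => 1 - Real.cos (t * layer a b x)) = fun x : ℝ =>
        (Set.Ioc a b).indicator (fun r => 1 - Real.cos (t * r)) |x| := by
      ext x
      unfold layer
      split_ifs with h
      · rw [Set.indicator_of_mem (s := Set.Ioc a b) h]
        rcases abs_choice x with hx | hx <;> rw [hx]
        rw [mul_neg, Real.cos_neg]
      · rw [Set.indicator_of_notMem (s := Set.Ioc a b) h]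
        simp
    have e2 : (fun x : ℝ => (Set.Ioc a b).indicator (fun r => 1 - Real.cos (t * r)) x
        * (α * x ^ (-1 - α))) = (Set.Ioc a b).indicator
          fun x => (1 - Real.cos (t * x)) * (α * x ^ (-1 - α)) := by
      ext x
      by_cases hx : x ∈ Set.Ioc a b <;> simp only [hx, Set.indicator_of_mem,
        Set.indicator_of_notMem, not_false_eq_true, zero_mul]
    rw [e, integral_symmPareto_comp_abs hα, e2, setIntegral_indicator measurableSet_Ioc,
      Set.inter_eq_right.2 (Set.Ioc_subset_Ioi_self.trans (Set.Ioi_subset_Ioi ha)),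
      levyExponent, intervalIntegral.integral_of_le hab]
  rw [integral_sub (integrable_const _) hcos] at h3
  simp only [integral_const, probReal_univ, one_smul] at h3
  rw [h1, h2, ← h3]
  simp

theorem levyExponent_neg (α a b t : ℝ) : levyExponent α a b (-t) = levyExponent α a b t := by
  simp [levyExponent]

theorem levyExponent_nonneg (hα : 0 < α) {a b : ℝ} (ha : 0 < a) (hab : a ≤ b) (t : ℝ) :
    0 ≤ levyExponent α a b t := by
  refine intervalIntegral.integral_nonneg hab fun x hx => ?_
  have hx0 : 0 < x := ha.trans_le hx.1
  exact mul_nonneg (sub_nonneg.2 (Real.cos_le_one _)) (by positivity)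

theorem levyExponent_le (hα : 0 < α) {a b : ℝ} (ha : 0 < a) (hab : a ≤ b) (t : ℝ) :
    levyExponent α a b t ≤ 2 * a ^ (-α) := by
  have hi : IntegrableOn (fun x : ℝ => 2 * (α * x ^ (-1 - α))) (Set.Ioi a) :=
    ((integrableOn_Ioi_rpow_of_lt (by linarith) ha).const_mul α).const_mul 2
  have hpos : ∀ x ∈ Set.Ioi a, 0 ≤ α * x ^ (-1 - α) := fun x hx => by
    have : 0 < x := ha.trans hx
    positivity
  rw [← integral_Ioi_paretoDensity hα ha, ← integral_const_mul, levyExponent,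
    intervalIntegral.integral_of_le hab]
  refine (setIntegral_mono_on ((intervalIntegrable_iff_integrableOn_Ioc_of_le hab).1
    (intervalIntegrable_levy α t ha (ha.trans_le hab))) (hi.mono_set Set.Ioc_subset_Ioi_self)
    measurableSet_Ioc fun x hx => ?_).trans (setIntegral_mono_set hi
      ((ae_restrict_iff' measurableSet_Ioi).2 (Eventually.of_forall fun x hx =>
        mul_nonneg zero_le_two (hpos x hx)))
      (LE.le.eventuallyLE Set.Ioc_subset_Ioi_self))
  refine mul_le_mul_of_nonneg_right ?_ (hpos x hx.1)
  linarith [Real.neg_one_le_cos (t * x)]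

theorem sum_levyExponent (α t : ℝ) {a : ℕ → ℝ} (ha : ∀ k, 0 < a k) {K L : ℕ} (hKL : K ≤ L) :
    ∑ k ∈ Finset.Ico K L, levyExponent α (a k) (a (k + 1)) t = levyExponent α (a K) (a L) t :=
  intervalIntegral.sum_integral_adjacent_intervals_Ico hKL fun k _ =>
    intervalIntegrable_levy α t (ha k) (ha (k + 1))

/-- Self-similarity of the Lévy density. -/
theorem levyExponent_scale (α : ℝ) {a b t : ℝ} (ha : 0 < a) (hab : a ≤ b) (ht : 0 < t) :
    levyExponent α a b t = t ^ α * levyExponent α (t * a) (t * b) 1 := by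
  have h := intervalIntegral.integral_comp_mul_left (a := a) (b := b)
    (fun u => (1 - Real.cos (1 * u)) * (α * u ^ (-1 - α))) ht.ne'
  rw [smul_eq_mul] at h
  have h2 : levyExponent α (t * a) (t * b) 1 = t * ∫ x in a..b,
      (1 - Real.cos (1 * (t * x))) * (α * (t * x) ^ (-1 - α)) := by
    rw [h, levyExponent, ← mul_assoc, mul_inv_cancel₀ ht.ne', one_mul]
  rw [h2, ← mul_assoc, ← intervalIntegral.integral_const_mul, levyExponent]
  refine intervalIntegral.integral_congr fun x hx => ?_
  rw [Set.uIcc_of_le hab] at hx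
  have hx0 : 0 < x := ha.trans_le hx.1
  have e : t ^ α * t * t ^ (-1 - α) = 1 := by
    rw [← Real.rpow_add_one ht.ne', ← Real.rpow_add ht,
      show α + 1 + (-1 - α) = 0 by ring, Real.rpow_zero]
  rw [one_mul, Real.mul_rpow ht.le hx0.le]
  linear_combination (-(1 - Real.cos (t * x)) * (α * x ^ (-1 - α))) * e

/-- The Lévy density integrates `1 - cos` on the whole half-line: near `0` because `α < 2`, near
infinity because `0 < α`. -/
theorem integrableOn_levy (hα : 0 < α) (hα₂ : α < 2) :
    IntegrableOn (fun x => (1 - Real.cos (1 * x)) * (α * x ^ (-1 - α))) (Set.Ioi 0) := by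
  have hm : Measurable fun x : ℝ => (1 - Real.cos (1 * x)) * (α * x ^ (-1 - α)) := by fun_prop
  rw [← Set.Ioc_union_Ioi_eq_Ioi zero_le_one]
  refine IntegrableOn.union ?_ ?_
  · have h1 : IntegrableOn (fun x : ℝ => α * x ^ (1 - α)) (Set.Ioc 0 1) :=
      ((intervalIntegrable_iff_integrableOn_Ioc_of_le zero_le_one).1
        (intervalIntegral.intervalIntegrable_rpow' (by linarith))).const_mul α
    refine Integrable.mono' h1 hm.aestronglyMeasurable
      ((ae_restrict_iff' measurableSet_Ioc).2 (Eventually.of_forall fun x hx => ?_))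
    have hx0 : 0 < x := hx.1
    have hc : 0 ≤ 1 - Real.cos (1 * x) := sub_nonneg.2 (Real.cos_le_one _)
    have hc2 : 1 - Real.cos (1 * x) ≤ x ^ (2 : ℝ) := by
      rw [one_mul, Real.rpow_two]
      nlinarith [Real.one_sub_sq_div_two_le_cos (x := x), sq_nonneg x]
    rw [Real.norm_of_nonneg (by positivity)]
    calc (1 - Real.cos (1 * x)) * (α * x ^ (-1 - α)) ≤ x ^ (2 : ℝ) * (α * x ^ (-1 - α)) :=
          mul_le_mul_of_nonneg_right hc2 (by positivity)
      _ = α * x ^ (1 - α) := by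
          rw [mul_left_comm, ← Real.rpow_add hx0]
          congr 2
          ring
  · have h1 : IntegrableOn (fun x : ℝ => 2 * (α * x ^ (-1 - α))) (Set.Ioi 1) :=
      ((integrableOn_Ioi_rpow_of_lt (by linarith) one_pos).const_mul α).const_mul 2
    refine Integrable.mono' h1 hm.aestronglyMeasurable
      ((ae_restrict_iff' measurableSet_Ioi).2 (Eventually.of_forall fun x hx => ?_))
    have hx0 : 0 < x := one_pos.trans hx
    have hc : 0 ≤ 1 - Real.cos (1 * x) := sub_nonneg.2 (Real.cos_le_one _)
    rw [Real.norm_of_nonneg (by positivity)]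
    refine mul_le_mul_of_nonneg_right ?_ (by positivity)
    linarith [Real.neg_one_le_cos (1 * x)]

/-- The integral of `1 - cos x` against the Lévy density `α x ^ (-1 - α)` over `a < x`. -/
noncomputable def levyTail (α a : ℝ) : ℝ :=
  ∫ x in Set.Ioi a, (1 - Real.cos (1 * x)) * (α * x ^ (-1 - α))

theorem levyTail_zero_pos (hα : 0 < α) (hα₂ : α < 2) : 0 < levyTail α 0 := by
  have h1 : 0 < levyExponent α 1 2 1 := by
    refine intervalIntegral.intervalIntegral_pos_of_pos_on
      (intervalIntegrable_levy α 1 one_pos two_pos) (fun x hx => ?_) one_lt_two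
    have hx0 : 0 < x := one_pos.trans hx.1
    refine mul_pos (sub_pos.2 ?_) (by positivity)
    have := Real.cos_lt_cos_of_nonneg_of_le_pi le_rfl
      (show 1 * x ≤ Real.pi by linarith [Real.pi_gt_three, hx.2]) (show 0 < 1 * x by linarith)
    rwa [Real.cos_zero] at this
  refine h1.trans_le ?_
  rw [levyExponent, intervalIntegral.integral_of_le one_le_two]
  refine setIntegral_mono_set (integrableOn_levy hα hα₂)
    ((ae_restrict_iff' measurableSet_Ioi).2 (Eventually.of_forall fun x hx => ?_))
    (LE.le.eventuallyLE fun x hx => one_pos.trans hx.1)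
  have hx0 : 0 < x := hx
  exact mul_nonneg (sub_nonneg.2 (Real.cos_le_one _)) (by positivity)

theorem tendsto_levyExponent_atTop (hα : 0 < α) (hα₂ : α < 2) {a : ℝ} (ha : 0 ≤ a) {b : ℕ → ℝ}
    (hb : Tendsto b atTop atTop) :
    Tendsto (fun L => levyExponent α a (b L) 1) atTop
      (𝓝 (levyTail α a)) :=
  intervalIntegral_tendsto_integral_Ioi a
    ((integrableOn_levy hα hα₂).mono_set (Set.Ioi_subset_Ioi ha)) hb

theorem tendsto_levyTail_zero (hα : 0 < α) (hα₂ : α < 2) {a : ℕ → ℝ} (ha : ∀ n, 0 ≤ a n)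
    (hlim : Tendsto a atTop (𝓝 0)) :
    Tendsto (fun n => levyTail α (a n)) atTop (𝓝 (levyTail α 0)) := by
  have h := (integrableOn_levy hα hα₂).continuousWithinAt_Ici_primitive_Ioi
  exact h.tendsto.comp (tendsto_nhdsWithin_iff.2 ⟨hlim, Eventually.of_forall ha⟩)

end Pareto

/-! ### Birkhoff sums of the series of coboundaries -/

section Series

open Topology

variable {X : Type*} {T : X → X} {W : ℕ → X → ℝ} {d : ℕ → ℕ}

/-- The Birkhoff sums of a coboundary `W - W ∘ T^d` are symmetric in the two lengths. -/
theorem birkhoffSum_coboundary (W : X → ℝ) (d n : ℕ) (x : X) :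
    birkhoffSum T (fun x => W x - W (T^[d] x)) n x
      = birkhoffSum T W d x - birkhoffSum T W d (T^[n] x) := by
  have h1 := birkhoffSum_add T W n d x
  have h2 := birkhoffSum_add T W d n x
  have h3 : birkhoffSum T (fun x => W x - W (T^[d] x)) n x
      = birkhoffSum T W n x - birkhoffSum T W n (T^[d] x) := by
    simp only [birkhoffSum, Finset.sum_sub_distrib, ← Function.iterate_add_apply, add_comm]
  rw [add_comm d n] at h2
  rw [h3]
  linarith

theorem birkhoffSum_coboundarySum (W : ℕ → X → ℝ) (d : ℕ → ℕ) (K L n : ℕ) (x : X) :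
    birkhoffSum T (coboundarySum T W d K L) n x
      = ∑ k ∈ Finset.Ico K L,
        (birkhoffSum T (W k) (d k) x - birkhoffSum T (W k) (d k) (T^[n] x)) := by
  simp_rw [← birkhoffSum_coboundary]
  exact Finset.sum_comm

variable [MeasurableSpace X] {m : Measure X} [IsProbabilityMeasure m]

theorem integrable_birkhoffSum (hT : MeasurePreserving T m m) {F : X → ℝ} (hF : Measurable F)
    {b : ℝ} (hb : ∀ x, |F x| ≤ b) (n : ℕ) : Integrable (birkhoffSum T F n) m :=
  Integrable.of_bound (measurable_birkhoffSum hT.measurable hF n).aestronglyMeasurable _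
    (Eventually.of_forall (abs_birkhoffSum_le hb n))

/-- The Birkhoff sums of finitely many coboundaries are bounded in `L¹`, uniformly in time. -/
theorem integral_abs_birkhoffSum_coboundarySum_le (hT : MeasurePreserving T m m)
    (hW : ∀ k, Measurable (W k)) {B : ℕ → ℝ} (hB : ∀ k x, |W k x| ≤ B k) (K L n : ℕ) :
    ∫ x, |birkhoffSum T (coboundarySum T W d K L) n x| ∂m
      ≤ ∑ k ∈ Finset.Ico K L, 2 * ∫ x, |birkhoffSum T (W k) (d k) x| ∂m := by
  have hi : ∀ k, Integrable (fun x => |birkhoffSum T (W k) (d k) x|) m := fun k =>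
    (integrable_birkhoffSum hT (hW k) (hB k) (d k)).abs
  have hi' : ∀ k, Integrable (fun x => |birkhoffSum T (W k) (d k) (T^[n] x)|) m := fun k =>
    (hT.iterate n).integrable_comp_of_integrable (hi k)
  have he : ∀ k, ∫ x, |birkhoffSum T (W k) (d k) (T^[n] x)| ∂m
      = ∫ x, |birkhoffSum T (W k) (d k) x| ∂m := fun k => by
    have h := integral_map (μ := m) (hT.iterate n).measurable.aemeasurable
      (f := fun y => |birkhoffSum T (W k) (d k) y|)
      (by rw [(hT.iterate n).map_eq]; exact (hi k).aestronglyMeasurable)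
    rw [(hT.iterate n).map_eq] at h
    exact h.symm
  calc ∫ x, |birkhoffSum T (coboundarySum T W d K L) n x| ∂m
      ≤ ∫ x, ∑ k ∈ Finset.Ico K L, (|birkhoffSum T (W k) (d k) x|
          + |birkhoffSum T (W k) (d k) (T^[n] x)|) ∂m := by
        refine integral_mono_of_nonneg (Eventually.of_forall fun x => abs_nonneg _)
          (integrable_finsetSum _ fun k _ => (hi k).add (hi' k))
          (Eventually.of_forall fun x => ?_)
        dsimp only
        rw [birkhoffSum_coboundarySum]
        exact (Finset.abs_sum_le_sum_abs _ _).trans (Finset.sum_le_sum fun k _ => abs_sub _ _)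
    _ = ∑ k ∈ Finset.Ico K L, 2 * ∫ x, |birkhoffSum T (W k) (d k) x| ∂m := by
        refine (integral_finsetSum _ fun k _ => (hi k).add (hi' k)).trans ?_
        refine Finset.sum_congr rfl fun k _ => ?_
        exact (integral_add (hi k) (hi' k)).trans (by rw [he, two_mul])

/-- If the supports of the `W k` have summable measures, then the series of coboundaries is
almost everywhere a finite sum. -/
theorem exists_limit_coboundarySum (hT : MeasurePreserving T m m) (hW : ∀ k, Measurable (W k))
    (hs : Summable fun k => m.real {x | W k x ≠ 0}) :
    ∃ f : X → ℝ, Measurable f ∧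
      ∀ᵐ x ∂m, Tendsto (fun L => coboundarySum T W d 0 L x) atTop (𝓝 (f x)) := by
  refine measurable_limit_of_tendsto_metrizable_ae
    (fun L => (measurable_coboundarySum hT.measurable hW d 0 L).aemeasurable) ?_
  have hs' : ∑' k, m {x | W k x ≠ 0} ≠ ⊤ := by
    have h := hs.tsum_ofReal_ne_top
    have e : ∀ k, ENNReal.ofReal (m.real {x | W k x ≠ 0}) = m {x | W k x ≠ 0} := fun k =>
      ofReal_measureReal
    simpa only [e] using h
  have h1 : ∀ᵐ x ∂m, ∀ᶠ k in atTop, x ∉ {x | W k x ≠ 0} := ae_eventually_notMem hs'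
  have h2 : ∀ᵐ x ∂m, ∀ᶠ k in atTop, T^[d k] x ∉ {x | W k x ≠ 0} := by
    have h3 : ∀ᵐ x ∂m, ∀ᶠ k in atTop, x ∉ T^[d k] ⁻¹' {x | W k x ≠ 0} := by
      refine ae_eventually_notMem ?_
      have h4 : ∀ k, m (T^[d k] ⁻¹' {x | W k x ≠ 0}) = m {x | W k x ≠ 0} := fun k =>
        (hT.iterate (d k)).measure_preimage
          ((hW k (measurableSet_singleton 0)).compl).nullMeasurableSet
      simpa only [h4] using hs'
    exact h3
  filter_upwards [h1, h2] with x h1 h2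
  obtain ⟨N, hN⟩ := eventually_atTop.1 (h1.and h2)
  refine ⟨coboundarySum T W d 0 N x, tendsto_const_nhds.congr' ?_⟩
  filter_upwards [eventually_ge_atTop N] with L hL
  rw [coboundarySum, coboundarySum, ← Finset.sum_Ico_consecutive _ (Nat.zero_le N) hL]
  refine (add_eq_left.2 (Finset.sum_eq_zero fun k hk => ?_)).symm
  obtain ⟨h3, h4⟩ := hN k (Finset.mem_Ico.1 hk).1
  rw [not_not.1 h3, not_not.1 h4, sub_zero]

theorem tendsto_charFn_birkhoffSum (hT : MeasurePreserving T m m) {F : ℕ → X → ℝ} {f : X → ℝ}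
    (hF : ∀ L, Measurable (F L)) (hlim : ∀ᵐ x ∂m, Tendsto (fun L => F L x) atTop (𝓝 (f x)))
    (n : ℕ) (t : ℝ) :
    Tendsto (fun L => charFn m (birkhoffSum T (F L) n) t) atTop
      (𝓝 (charFn m (birkhoffSum T f n) t)) := by
  refine tendsto_integral_of_dominated_convergence (fun _ => 1)
    (fun L => (measurable_phase.comp
      ((measurable_birkhoffSum hT.measurable (hF L) n).const_mul t)).aestronglyMeasurable)
    (integrable_const _) (fun L => Eventually.of_forall fun x => (norm_phase _).le) ?_
  have h : ∀ᵐ x ∂m, ∀ j, Tendsto (fun L => F L (T^[j] x)) atTop (𝓝 (f (T^[j] x))) :=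
    ae_all_iff.2 fun j => (hT.iterate j).quasiMeasurePreserving.ae hlim
  filter_upwards [h] with x hx
  exact continuous_phase.continuousAt.tendsto.comp
    ((tendsto_finsetSum _ fun j _ => hx j).const_mul t)

end Series

/-! ### Comparison with the infinitely divisible limit -/

section Comparison

open Topology

theorem abs_one_sub_sub_exp_neg_le {y : ℝ} (hy : 0 ≤ y) :
    |1 - y - Real.exp (-y)| ≤ y ^ 2 := by
  have h1 : 1 - y ≤ Real.exp (-y) := Real.one_sub_le_exp_neg y
  have h2 : Real.exp (-y) ≤ 1 - y + y ^ 2 := by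
    have h3 : Real.exp (-y) * (1 + y) ≤ 1 := by
      calc Real.exp (-y) * (1 + y) ≤ Real.exp (-y) * Real.exp y :=
            mul_le_mul_of_nonneg_left (by linarith [Real.add_one_le_exp y]) (Real.exp_pos _).le
        _ = 1 := by rw [← Real.exp_add, neg_add_cancel, Real.exp_zero]
    have h4 : Real.exp (-y) * (1 + y) ≤ (1 - y + y ^ 2) * (1 + y) := by
      have : (1 - y + y ^ 2) * (1 + y) = 1 + y ^ 3 := by ring
      rw [this]
      linarith [pow_nonneg hy 3]
    exact le_of_mul_le_mul_right h4 (by linarith)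
  rw [abs_le]
  constructor <;> linarith [sq_nonneg y]

theorem abs_one_sub_pow_sub_exp_le {y : ℝ} (hy : 0 ≤ y) (hy2 : y ≤ 2) (N : ℕ) :
    |(1 - y) ^ N - Real.exp (-(N * y))| ≤ N * y ^ 2 := by
  have e : Real.exp (-(N * y)) = Real.exp (-y) ^ N := by
    rw [← Real.exp_nat_mul]
    congr 1
    ring
  have h1 : |1 - y| ≤ 1 := abs_le.2 ⟨by linarith, by linarith⟩
  have h2 : |Real.exp (-y)| ≤ 1 := by
    rw [abs_of_pos (Real.exp_pos _)]
    exact Real.exp_le_one_iff.2 (by linarith)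
  rw [e]
  refine (abs_pow_sub_pow_le (a := 1 - y) (b := Real.exp (-y)) N).trans ?_
  have h3 : max |1 - y| |Real.exp (-y)| ^ (N - 1) ≤ 1 :=
    pow_le_one₀ ((abs_nonneg _).trans (le_max_left _ _)) (max_le h1 h2)
  calc |1 - y - Real.exp (-y)| * N * max |1 - y| |Real.exp (-y)| ^ (N - 1)
      ≤ y ^ 2 * N * 1 := by
        refine mul_le_mul ?_ h3 (by positivity) (by positivity)
        exact mul_le_mul_of_nonneg_right (abs_one_sub_sub_exp_neg_le hy) (Nat.cast_nonneg N)
    _ = N * y ^ 2 := by ring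

/-- A sequence which is multiplied at each step by approximately `(1 - y k) ^ N` stays close to
`exp (-N ∑ y k)`. -/
theorem norm_sub_exp_sum_le {φ : ℕ → ℂ} {y ε : ℕ → ℝ} {K N : ℕ} (hy : ∀ k, 0 ≤ y k)
    (hy2 : ∀ k, y k ≤ 2) (h0 : φ K = 1)
    (hstep : ∀ k, K ≤ k → ‖φ (k + 1) - φ k * (((1 - y k) ^ N : ℝ) : ℂ)‖ ≤ ε k) {L : ℕ}
    (hL : K ≤ L) :
    ‖φ L - ((Real.exp (-(N * ∑ k ∈ Finset.Ico K L, y k)) : ℝ) : ℂ)‖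
      ≤ ∑ k ∈ Finset.Ico K L, (ε k + N * y k ^ 2) := by
  induction L, hL using Nat.le_induction with
  | base => simp [h0]
  | succ L hL ih =>
    rw [Finset.sum_Ico_succ_top hL, Finset.sum_Ico_succ_top hL]
    set s := ∑ k ∈ Finset.Ico K L, y k with hs
    have hs0 : 0 ≤ s := Finset.sum_nonneg fun k _ => hy k
    have hexp : Real.exp (-(N * (s + y L))) = Real.exp (-(N * s)) * Real.exp (-(N * y L)) := by
      rw [← Real.exp_add]
      congr 1
      ring
    have h1 : |1 - y L| ≤ 1 := abs_le.2 ⟨by linarith [hy2 L], by linarith [hy L]⟩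
    have h2 : ‖(((1 - y L) ^ N : ℝ) : ℂ)‖ ≤ 1 := by
      rw [Complex.norm_real, Real.norm_eq_abs, abs_pow]
      exact pow_le_one₀ (abs_nonneg _) h1
    have h3 : ‖((Real.exp (-(N * s)) : ℝ) : ℂ)‖ ≤ 1 := by
      rw [Complex.norm_real, Real.norm_eq_abs, abs_of_pos (Real.exp_pos _)]
      exact Real.exp_le_one_iff.2 (neg_nonpos.2 (by positivity))
    have h4 : ‖(((1 - y L) ^ N : ℝ) : ℂ) - ((Real.exp (-(N * y L)) : ℝ) : ℂ)‖
        ≤ N * y L ^ 2 := by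
      rw [← Complex.ofReal_sub, Complex.norm_real]
      exact abs_one_sub_pow_sub_exp_le (hy L) (hy2 L) N
    calc ‖φ (L + 1) - ((Real.exp (-(N * (s + y L))) : ℝ) : ℂ)‖
        = ‖(φ (L + 1) - φ L * (((1 - y L) ^ N : ℝ) : ℂ))
            + (φ L - ((Real.exp (-(N * s)) : ℝ) : ℂ)) * (((1 - y L) ^ N : ℝ) : ℂ)
            + ((Real.exp (-(N * s)) : ℝ) : ℂ) * ((((1 - y L) ^ N : ℝ) : ℂ)
              - ((Real.exp (-(N * y L)) : ℝ) : ℂ))‖ := by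
          rw [hexp, Complex.ofReal_mul]
          congr 1
          ring
      _ ≤ ε L + (∑ k ∈ Finset.Ico K L, (ε k + N * y k ^ 2)) * 1 + 1 * (N * y L ^ 2) := by
          refine (norm_add₃_le).trans (add_le_add (add_le_add (hstep L hL) ?_) ?_)
          · rw [norm_mul]
            exact mul_le_mul ih h2 (norm_nonneg _) ((norm_nonneg _).trans ih)
          · rw [norm_mul]
            exact mul_le_mul h3 h4 (norm_nonneg _) zero_le_one
      _ = _ := by ring

end Comparison

/-! ### Limit laws from characteristic functions -/

section Levy

open Topology

/-- A pointwise limit of characteristic functions that is continuous at `0` is a characteristic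
function. -/
theorem exists_probabilityMeasure_charFun_eq {μ : ℕ → ProbabilityMeasure ℝ} {g : ℝ → ℂ}
    (hg : ContinuousAt g 0)
    (h : ∀ t, Tendsto (fun n => charFun (μ n : Measure ℝ) t) atTop (𝓝 (g t))) :
    ∃ ν : ProbabilityMeasure ℝ, ∀ t, charFun (ν : Measure ℝ) t = g t := by
  have ht : IsTightMeasureSet {((κ : ProbabilityMeasure ℝ) : Measure ℝ) | κ ∈ Set.range μ} := by
    have := isTightMeasureSet_of_tendsto_charFun (μ := fun n => (μ n : Measure ℝ)) hg h
    refine this.subset ?_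
    rintro _ ⟨_, ⟨n, rfl⟩, rfl⟩
    exact ⟨n, rfl⟩
  have hc := isCompact_closure_of_isTightMeasureSet ht
  set U : Ultrafilter ℕ := Ultrafilter.of atTop
  have hU : (U : Filter ℕ) ≤ atTop := Ultrafilter.of_le atTop
  obtain ⟨ν, -, hν⟩ := hc.ultrafilter_le_nhds (U.map μ)
    (by
      rw [le_principal_iff]
      exact mem_of_superset (Ultrafilter.mem_coe.2 (Ultrafilter.mem_map.2
        (Filter.univ_mem' fun n => Set.mem_range_self n))) subset_closure)
  have hν' : Tendsto μ U (𝓝 ν) := hν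
  refine ⟨ν, fun t => ?_⟩
  rw [ProbabilityMeasure.tendsto_iff_forall_integral_rclike_tendsto ℂ] at hν'
  have h1 := hν' (BoundedContinuousFunction.innerProbChar t)
  simp_rw [← charFun_eq_integral_innerProbChar] at h1
  exact tendsto_nhds_unique h1 ((h t).mono_left hU)

end Levy

/-! ### The observable -/

section Observable

open Topology

variable {X : Type*} {T : X → X} [MeasurableSpace X] [StandardBorelSpace X] {m : Measure X}
  [IsProbabilityMeasure m] {α : ℝ}

theorem rpow_inv_pow_rpow_neg (hα : 0 < α) (k : ℕ) :
    (((4 : ℝ) ^ (1 / α)) ^ k) ^ (-α) = (1 / 4) ^ k := by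
  rw [← Real.rpow_pow_comm (by positivity), ← Real.rpow_mul (by norm_num)]
  have : 1 / α * -α = -1 := by field_simp
  rw [this, Real.rpow_neg_one, one_div]

/-- The observable `f = ∑ k, (W k - W k ∘ T^(8^k))`, where the values of `W k` follow the symmetric
Pareto law on the layer `4^(k/α) < |x| ≤ 4^((k+1)/α)`. For `n ≤ 8^K` the layers `k ≥ K` contribute
to `S_n f` like `2 n` independent variables, and the layers `k < K` are bounded in `L¹`. -/
theorem exists_observable_charFn_approx (hT : MeasurePreserving T m m) (hap : IsAperiodic T m)
    (hα : 0 < α) (hα₂ : α < 2) :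
    ∃ f : X → ℝ, Measurable f ∧ ∃ D : ℝ, ∀ (K n : ℕ) (t : ℝ), n ≤ 8 ^ K → t ≠ 0 → |t| ≤ K →
      ‖charFn m (birkhoffSum T f n) t
        - ((Real.exp (-((2 * n : ℕ) * (|t| ^ α * levyTail α (|t| * (4 ^ (1 / α)) ^ K)))) : ℝ) : ℂ)‖
      ≤ |t| * (K * (D * (√2 * 4 ^ (1 / α)) ^ K)) + 18 * (1 / 2) ^ K := by
  set A : ℝ := 4 ^ (1 / α) with hA
  have hA1 : 1 < A := Real.one_lt_rpow (by norm_num) (by positivity)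
  have hA0 : 0 < A := one_pos.trans hA1
  have ha1 : ∀ k, 1 ≤ A ^ k := fun k => one_le_pow₀ hA1.le
  have ha0 : ∀ k, 0 < A ^ k := fun k => pow_pos hA0 k
  have hmono : ∀ k, A ^ k ≤ A ^ (k + 1) := fun k => pow_le_pow_right₀ hA1.le (Nat.le_succ k)
  have hneg : ∀ k, (A ^ k) ^ (-α) = (1 / 4) ^ k := rpow_inv_pow_rpow_neg hα
  have := isProbabilityMeasure_symmPareto hα
  obtain ⟨W, hWm, hWB, hstep, hE, hsupp⟩ := exists_components hT hap (symmPareto α)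
    (h := fun k => layer (A ^ k) (A ^ (k + 1))) (fun k => measurable_layer _ _)
    (B := fun k => A ^ (k + 1)) (fun k => abs_layer_le (ha0 _).le)
    (fun k => integral_symmPareto_eq_zero_of_odd hα (layer_neg _ _))
    (d := fun k => 8 ^ k) (fun k => by positivity) (ε := fun k => (1 / 2) ^ k)
    (fun k => by positivity)
  have hgeom : Summable fun k : ℕ => (1 / 2 : ℝ) ^ k :=
    summable_geometric_of_lt_one (by norm_num) (by norm_num)
  have hgeom' : Summable fun k : ℕ => (1 / 4 : ℝ) ^ k :=
    summable_geometric_of_lt_one (by norm_num) (by norm_num)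
  obtain ⟨f, hfm, hf⟩ := exists_limit_coboundarySum (d := fun k => 8 ^ k) hT hWm
    (Summable.of_nonneg_of_le (fun k => measureReal_nonneg)
      (fun k => (hsupp k).trans (add_le_add_left
        ((symmPareto_real_layer_ne_zero_le hα (ha1 k) _).trans_eq (hneg k)) _))
      (hgeom'.add hgeom))
  set r : ℝ := √2 * A with hr
  have hsq2 : 1 ≤ √2 := Real.one_le_sqrt.2 (by norm_num)
  have hr1 : 1 ≤ r := by
    rw [hr]
    exact one_le_mul_of_one_le_of_one_le hsq2 hA1.le
  -- The `L²` bound: `8 ^ k * A ^ (2 * (k + 1)) * 4 ^ (-k) = (A * (√2 * A) ^ k) ^ 2`.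
  have hE' : ∀ k, ∫ x, |birkhoffSum T (W k) (8 ^ k) x| ∂m ≤ (A + 1) * r ^ k := by
    intro k
    refine (hE k).trans ?_
    have h1 : ((8 ^ k : ℕ) : ℝ) * ∫ x, layer (A ^ k) (A ^ (k + 1)) x ^ 2 ∂symmPareto α
        ≤ (A * r ^ k) ^ 2 := by
      calc ((8 ^ k : ℕ) : ℝ) * ∫ x, layer (A ^ k) (A ^ (k + 1)) x ^ 2 ∂symmPareto α
          ≤ ((8 ^ k : ℕ) : ℝ) * ((A ^ (k + 1)) ^ 2 * (1 / 4) ^ k) := by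
            rw [← hneg k]
            exact mul_le_mul_of_nonneg_left (integral_layer_sq_le hα (ha1 k)) (by positivity)
        _ = (8 * (1 / 4)) ^ k * (A * A ^ k) ^ 2 := by
            push_cast
            rw [mul_pow 8]
            ring
        _ = (√2 ^ 2) ^ k * (A * A ^ k) ^ 2 := by
            rw [Real.sq_sqrt (by norm_num)]
            norm_num
        _ = (A * r ^ k) ^ 2 := by
            rw [hr]
            ring
    have h2 : √(((8 ^ k : ℕ) : ℝ) * ∫ x, layer (A ^ k) (A ^ (k + 1)) x ^ 2 ∂symmPareto α)
        ≤ A * r ^ k := by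
      rw [← Real.sqrt_sq (show 0 ≤ A * r ^ k by positivity)]
      exact Real.sqrt_le_sqrt h1
    have h3 : (1 / 2 : ℝ) ^ k ≤ r ^ k := pow_le_pow_left₀ (by norm_num) (by linarith) k
    linarith
  refine ⟨f, hfm, 2 * (A + 1), fun K n t hn ht htK => ?_⟩
  set y : ℕ → ℝ := fun k => levyExponent α (A ^ k) (A ^ (k + 1)) t with hy
  have hy0 : ∀ k, 0 ≤ y k := fun k => levyExponent_nonneg hα (ha0 k) (hmono k) t
  have hy1 : ∀ k, y k ≤ 2 * (1 / 4) ^ k := fun k =>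
    (levyExponent_le hα (ha0 k) (hmono k) t).trans_eq (by rw [hneg])
  have hy2 : ∀ k, y k ≤ 2 := fun k => by
    have : (1 / 4 : ℝ) ^ k ≤ 1 := pow_le_one₀ (by norm_num) (by norm_num)
    linarith [hy1 k]
  -- The layers `k ≥ K`: the error terms are at most `9 * (1 / 2) ^ k` because `n ≤ 8 ^ k`.
  have hlarge : ∀ L, K ≤ L →
      ‖charFn m (birkhoffSum T (coboundarySum T W (fun k => 8 ^ k) K L) n) t
        - ((Real.exp (-((2 * n : ℕ) * levyExponent α (A ^ K) (A ^ L) t)) : ℝ) : ℂ)‖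
      ≤ 18 * (1 / 2) ^ K := by
    intro L hL
    have h1 := norm_sub_exp_sum_le (N := 2 * n) (K := K) hy0 hy2
      (φ := fun L => charFn m (birkhoffSum T (coboundarySum T W (fun k => 8 ^ k) K L) n) t)
      (ε := fun k => (1 / 2) ^ k)
      (by
        have : birkhoffSum T (coboundarySum T W (fun k => 8 ^ k) K K) n = fun _ => 0 := by
          ext x
          rw [birkhoffSum_coboundarySum]
          simp
        simp [this, charFn, phase_zero])
      (fun k hk => by
        have h2 := hstep k K hk n (hn.trans (Nat.pow_le_pow_right (by norm_num) hk)) t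
          (htK.trans (Nat.cast_le.2 hk))
        rw [charFn_layer hα (ha1 k) (hmono k), charFn_layer hα (ha1 k) (hmono k),
          levyExponent_neg, ← Complex.ofReal_mul, ← Complex.ofReal_pow, ← sq, ← pow_mul] at h2
        exact h2) hL
    rw [sum_levyExponent α t ha0 hL] at h1
    refine h1.trans ?_
    have h3 : ∀ k ∈ Finset.Ico K L, (1 / 2 : ℝ) ^ k + ((2 * n : ℕ) : ℝ) * y k ^ 2
        ≤ 9 * (1 / 2) ^ k := by
      intro k hk
      have h4 : ((2 * n : ℕ) : ℝ) ≤ 2 * 8 ^ k := by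
        have : n ≤ 8 ^ k :=
          hn.trans (Nat.pow_le_pow_right (by norm_num) (Finset.mem_Ico.1 hk).1)
        exact_mod_cast Nat.mul_le_mul_left 2 this
      have h5 : y k ^ 2 ≤ (2 * (1 / 4) ^ k) ^ 2 := pow_le_pow_left₀ (hy0 k) (hy1 k) 2
      have h6 := mul_le_mul h4 h5 (sq_nonneg _) (by positivity)
      have h7 : (2 * 8 ^ k : ℝ) * (2 * (1 / 4) ^ k) ^ 2 = 8 * (8 * (1 / 4) * (1 / 4)) ^ k := by
        rw [mul_pow (8 * (1 / 4) : ℝ), mul_pow (8 : ℝ)]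
        ring
      rw [h7] at h6
      norm_num at h6 ⊢
      linarith
    refine (Finset.sum_le_sum h3).trans ?_
    rw [← Finset.mul_sum]
    have h8 := geom_sum_Ico_le_of_lt_one (x := (1 / 2 : ℝ)) (m := K) (n := L) (by norm_num)
      (by norm_num)
    norm_num at h8 ⊢
    linarith
  -- The layers `k < K` are removed at the cost of an `L¹` error.
  have hsmall : ∀ L, K ≤ L →
      ‖charFn m (birkhoffSum T (coboundarySum T W (fun k => 8 ^ k) 0 L) n) t
        - charFn m (birkhoffSum T (coboundarySum T W (fun k => 8 ^ k) K L) n) t‖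
      ≤ |t| * (K * (2 * (A + 1) * r ^ K)) := by
    intro L hL
    have hm1 := fun K L => measurable_birkhoffSum hT.measurable
      (measurable_coboundarySum hT.measurable hWm (fun k => 8 ^ k) K L) n
    have hi := fun K L => integrable_birkhoffSum hT
      (measurable_coboundarySum hT.measurable hWm (fun k => 8 ^ k) K L)
      (abs_coboundarySum_le hWB (fun k => 8 ^ k) K L) n
    refine (norm_charFn_sub_charFn_le (hm1 0 L).aemeasurable (hm1 K L).aemeasurable
      ((hi 0 L).sub (hi K L)) t).trans (mul_le_mul_of_nonneg_left ?_ (abs_nonneg t))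
    have e : ∀ x, birkhoffSum T (coboundarySum T W (fun k => 8 ^ k) 0 L) n x
        - birkhoffSum T (coboundarySum T W (fun k => 8 ^ k) K L) n x
        = birkhoffSum T (coboundarySum T W (fun k => 8 ^ k) 0 K) n x := by
      intro x
      simp_rw [birkhoffSum_coboundarySum]
      rw [← Finset.sum_Ico_consecutive _ (Nat.zero_le K) hL, add_sub_cancel_right]
    simp_rw [e]
    refine (integral_abs_birkhoffSum_coboundarySum_le hT hWm hWB 0 K n).trans ?_
    refine (Finset.sum_le_card_nsmul _ _ (2 * (A + 1) * r ^ K) fun k hk => ?_).trans (by simp)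
    have h1 : r ^ k ≤ r ^ K := pow_le_pow_right₀ hr1 (Finset.mem_Ico.1 hk).2.le
    have h2 := mul_le_mul_of_nonneg_left h1 (show 0 ≤ A + 1 by positivity)
    linarith [hE' k]
  -- Let the number `L` of components tend to infinity.
  have ht0 : 0 < |t| := abs_pos.2 ht
  have hscale : ∀ L, K ≤ L → levyExponent α (A ^ K) (A ^ L) t
      = |t| ^ α * levyExponent α (|t| * A ^ K) (|t| * A ^ L) 1 := fun L hL => by
    rw [← levyExponent_scale α (ha0 K) (pow_le_pow_right₀ hA1.le hL) ht0]
    rcases abs_choice t with h | h <;> rw [h]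
    rw [levyExponent_neg]
  have hlim1 := tendsto_charFn_birkhoffSum hT
    (fun L => measurable_coboundarySum hT.measurable hWm (fun k => 8 ^ k) 0 L) hf n t
  have hlim2 : Tendsto (fun L => ((Real.exp (-((2 * n : ℕ) *
      levyExponent α (A ^ K) (A ^ L) t)) : ℝ) : ℂ)) atTop
      (𝓝 ((Real.exp (-((2 * n : ℕ) * (|t| ^ α * levyTail α (|t| * A ^ K)))) : ℝ) : ℂ)) := by
    have h1 : Tendsto (fun L => |t| * A ^ L) atTop atTop :=
      (tendsto_pow_atTop_atTop_of_one_lt hA1).const_mul_atTop ht0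
    have h2 := tendsto_levyExponent_atTop hα hα₂
      (show 0 ≤ |t| * A ^ K by positivity) h1
    have h3 : Tendsto (fun L => levyExponent α (A ^ K) (A ^ L) t) atTop
        (𝓝 (|t| ^ α * levyTail α (|t| * A ^ K))) := by
      refine (h2.const_mul (|t| ^ α)).congr' ?_
      filter_upwards [eventually_ge_atTop K] with L hL
      exact (hscale L hL).symm
    exact (Complex.continuous_ofReal.tendsto _).comp
      ((Real.continuous_exp.tendsto _).comp (h3.const_mul _).neg)
  refine le_of_tendsto (hlim1.sub hlim2).norm ?_
  filter_upwards [eventually_ge_atTop K] with L hL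
  refine (norm_sub_le_norm_sub_add_norm_sub _
    (charFn m (birkhoffSum T (coboundarySum T W (fun k => 8 ^ k) K L) n) t) _).trans ?_
  exact add_le_add (hsmall L hL) (hlarge L hL)

/-- For the same observable, the normalised Birkhoff sums have a stable limit, at first with the
dispersion parameter given by the Pareto law. -/
theorem exists_observable_tendsto_charFn (hT : MeasurePreserving T m m) (hap : IsAperiodic T m)
    (hα : 0 < α) (hα₂ : α < 2) :
    ∃ f : X → ℝ, Measurable f ∧ ∀ θ : ℝ,
      Tendsto (fun n : ℕ => charFn m (birkhoffSum T f n) (θ / (n : ℝ) ^ (1 / α))) atTop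
        (𝓝 ((Real.exp (-(2 * levyTail α 0 * |θ| ^ α)) : ℝ) : ℂ)) := by
  obtain ⟨f, hfm, D, hf⟩ := exists_observable_charFn_approx hT hap hα hα₂
  refine ⟨f, hfm, fun θ => ?_⟩
  rcases eq_or_ne θ 0 with rfl | hθ
  · simp [charFn, phase_zero, Real.zero_rpow hα.ne']
  -- The scale `K = K n` is the least one with `n ≤ 8 ^ K`.
  set K : ℕ → ℕ := Nat.clog 8 with hK
  have hnK : ∀ n, n ≤ 8 ^ K n := fun n => Nat.le_pow_clog (by norm_num) n
  have hKlim : Tendsto K atTop atTop := by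
    refine tendsto_atTop_atTop.2 fun b => ⟨8 ^ b, fun n hn => ?_⟩
    by_contra h
    have h1 : 8 ^ K n < 8 ^ b := Nat.pow_lt_pow_right (by norm_num) (not_le.1 h)
    have := hnK n
    omega
  set A : ℝ := 4 ^ (1 / α) with hA
  set E : ℝ := 8 ^ (1 / α) with hE
  have hA0 : 0 < A := by positivity
  have hE0 : 0 < E := by positivity
  have hnE : ∀ᶠ n : ℕ in atTop, E ^ K n ≤ E * (n : ℝ) ^ (1 / α) := by
    filter_upwards [eventually_ge_atTop 2] with n hn
    have h1 : 8 ^ (K n - 1) < n := Nat.pow_pred_clog_lt_self (by norm_num) (by omega)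
    have h2 : 0 < K n := Nat.clog_pos (by norm_num) hn
    have h3 : E ^ (K n - 1) ≤ (n : ℝ) ^ (1 / α) := by
      rw [hE, Real.rpow_pow_comm (by norm_num)]
      exact Real.rpow_le_rpow (by positivity) (by exact_mod_cast h1.le) (by positivity)
    calc E ^ K n = E * E ^ (K n - 1) := by rw [← pow_succ', Nat.sub_add_cancel h2]
      _ ≤ _ := mul_le_mul_of_nonneg_left h3 hE0.le
  set t : ℕ → ℝ := fun n => θ / (n : ℝ) ^ (1 / α) with ht
  have htabs : ∀ n, |t n| = |θ| / (n : ℝ) ^ (1 / α) := fun n => by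
    rw [ht]
    dsimp only
    rw [abs_div, abs_of_nonneg (show (0 : ℝ) ≤ (n : ℝ) ^ (1 / α) by positivity)]
  have htK : ∀ᶠ n : ℕ in atTop, |t n| ≤ |θ| * E / E ^ K n := by
    filter_upwards [hnE, eventually_ge_atTop 1] with n hn hn1
    have hpos : 0 < (n : ℝ) ^ (1 / α) := Real.rpow_pos_of_pos (by exact_mod_cast hn1) _
    rw [htabs, div_le_div_iff₀ hpos (by positivity), mul_assoc]
    exact mul_le_mul_of_nonneg_left hn (abs_nonneg θ)
  -- The two ratios of scales that have to be smaller than one.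
  have hA_E : A / E < 1 := by
    rw [div_lt_one hE0]
    exact Real.rpow_lt_rpow (by norm_num) (by norm_num) (by positivity)
  have hr_E : √2 * A / E < 1 := by
    have h8 : E = 2 ^ (1 / α) * A := by
      rw [hE, hA, ← Real.mul_rpow (by norm_num) (by norm_num)]
      norm_num
    rw [div_lt_one hE0, h8]
    refine mul_lt_mul_of_pos_right ?_ hA0
    rw [Real.sqrt_eq_rpow]
    exact Real.rpow_lt_rpow_of_exponent_lt (by norm_num) (one_div_lt_one_div_of_lt hα hα₂)
  have hlimA : Tendsto (fun n => |t n| * A ^ K n) atTop (𝓝 0) := by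
    have h1 : Tendsto (fun n => |θ| * E * (A / E) ^ K n) atTop (𝓝 0) := by
      have := ((tendsto_pow_atTop_nhds_zero_of_lt_one (by positivity) hA_E).comp
        hKlim).const_mul (|θ| * E)
      simpa using this
    refine squeeze_zero' (Eventually.of_forall fun n => by positivity) ?_ h1
    filter_upwards [htK] with n hn
    calc |t n| * A ^ K n ≤ |θ| * E / E ^ K n * A ^ K n :=
          mul_le_mul_of_nonneg_right hn (by positivity)
      _ = |θ| * E * (A / E) ^ K n := by
          rw [div_pow]
          ring
  have herr1 : Tendsto (fun n => |t n| * (K n * (|D| * (√2 * A) ^ K n))) atTop (𝓝 0) := by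
    have h1 : Tendsto (fun n => |θ| * E * |D| * (K n * (√2 * A / E) ^ K n)) atTop (𝓝 0) := by
      have := ((tendsto_self_mul_const_pow_of_lt_one (by positivity) hr_E).comp
        hKlim).const_mul (|θ| * E * |D|)
      simpa using this
    refine squeeze_zero' (Eventually.of_forall fun n => by positivity) ?_ h1
    filter_upwards [htK] with n hn
    calc |t n| * (K n * (|D| * (√2 * A) ^ K n))
        ≤ |θ| * E / E ^ K n * (K n * (|D| * (√2 * A) ^ K n)) :=
          mul_le_mul_of_nonneg_right hn (by positivity)
      _ = |θ| * E * |D| * (K n * (√2 * A / E) ^ K n) := by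
          rw [div_pow]
          ring
  have herr2 : Tendsto (fun n => 18 * (1 / 2 : ℝ) ^ K n) atTop (𝓝 0) := by
    have := ((tendsto_pow_atTop_nhds_zero_of_lt_one (by norm_num)
      (show (1 / 2 : ℝ) < 1 by norm_num)).comp hKlim).const_mul 18
    simpa using this
  have herr := herr1.add herr2
  rw [add_zero] at herr
  have hmain : Tendsto (fun n => ((Real.exp (-((2 * n : ℕ) * (|t n| ^ α *
      levyTail α (|t n| * A ^ K n)))) : ℝ) : ℂ)) atTop
      (𝓝 ((Real.exp (-(2 * levyTail α 0 * |θ| ^ α)) : ℝ) : ℂ)) := by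
    have h1 := tendsto_levyTail_zero hα hα₂ (fun n => by positivity) hlimA
    have h2 : Tendsto (fun n => ((2 * n : ℕ) : ℝ) * (|t n| ^ α *
        levyTail α (|t n| * A ^ K n))) atTop (𝓝 (2 * levyTail α 0 * |θ| ^ α)) := by
      have h3 := h1.const_mul (2 * |θ| ^ α)
      rw [mul_right_comm] at h3
      refine h3.congr' ?_
      filter_upwards [eventually_ge_atTop 1] with n hn
      have hn0 : (0 : ℝ) < n := by exact_mod_cast hn
      have h4 : |t n| ^ α = |θ| ^ α / n := by
        rw [htabs, Real.div_rpow (abs_nonneg _) (by positivity), ← Real.rpow_mul hn0.le,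
          one_div_mul_cancel hα.ne', Real.rpow_one]
      rw [h4]
      push_cast
      field_simp
    exact (Complex.continuous_ofReal.tendsto _).comp ((Real.continuous_exp.tendsto _).comp h2.neg)
  have htsmall : ∀ᶠ n in atTop, |t n| ≤ K n := by
    have h1 : Tendsto (fun n => (K n : ℝ)) atTop atTop :=
      tendsto_natCast_atTop_atTop.comp hKlim
    filter_upwards [h1.eventually_ge_atTop |θ|, eventually_ge_atTop 1] with n hn hn1
    refine le_trans ?_ hn
    rw [htabs]
    exact div_le_self (abs_nonneg θ)
      (Real.one_le_rpow (by exact_mod_cast hn1) (by positivity))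
  have hdiff : Tendsto (fun n => charFn m (birkhoffSum T f n) (t n)
      - ((Real.exp (-((2 * n : ℕ) * (|t n| ^ α * levyTail α (|t n| * A ^ K n)))) : ℝ) : ℂ))
      atTop (𝓝 0) := by
    refine squeeze_zero_norm' ?_ herr
    filter_upwards [htsmall, eventually_ge_atTop 1] with n hn hn1
    have hpos : 0 < (n : ℝ) ^ (1 / α) := Real.rpow_pos_of_pos (by exact_mod_cast hn1) _
    refine (hf (K n) n (t n) (hnK n) (div_ne_zero hθ hpos.ne') hn).trans ?_
    gcongr
    exact le_abs_self D
  simpa only [sub_add_cancel, zero_add] using hdiff.add hmain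

end Observable

/-! ### Convergence to the stable law -/

theorem theorem1 {X : Type*} [MeasurableSpace X] [StandardBorelSpace X]
    (m : Measure X) [IsProbabilityMeasure m] (T : X → X)
    (hT : Ergodic T m) (hT' : IsAperiodic T m)
    (α σ : ℝ) (hα₀ : 0 < α) (hα₂ : α < 2) (hσ : 0 < σ) :
    ∃ f : X → ℝ, Measurable f ∧
      ∃ ν : ProbabilityMeasure ℝ, IsSymmetricStable α σ ν ∧
        TendstoInDistribution
          (fun (n : ℕ) (x : X) => (1 / (n : ℝ) ^ (1 / α)) * birkhoffSum T f n x)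
          atTop (fun y : ℝ => y) (fun _ => m) (ν : Measure ℝ) := by
  have hTm := hT.toMeasurePreserving
  obtain ⟨f, hfm, hf⟩ := exists_observable_tendsto_charFn hTm hT' hα₀ hα₂
  have hC : 0 < 2 * levyTail α 0 := mul_pos two_pos (levyTail_zero_pos hα₀ hα₂)
  -- Rescaling the observable adjusts the dispersion parameter.
  set c : ℝ := σ / (2 * levyTail α 0) ^ (1 / α) with hc
  have hc0 : 0 < c := by positivity
  have hcα : 2 * levyTail α 0 * c ^ α = σ ^ α := by
    rw [hc, Real.div_rpow hσ.le (by positivity), ← Real.rpow_mul hC.le,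
      one_div_mul_cancel hα₀.ne', Real.rpow_one]
    exact mul_div_cancel₀ _ hC.ne'
  have hgm : Measurable fun x => c * f x := hfm.const_mul c
  set Y : ℕ → X → ℝ := fun n x =>
    (1 / (n : ℝ) ^ (1 / α)) * birkhoffSum T (fun x => c * f x) n x with hY
  have hYm : ∀ n, Measurable (Y n) := fun n =>
    (measurable_birkhoffSum hTm.measurable hgm n).const_mul _
  have hchar : ∀ θ, Tendsto (fun n => charFun (m.map (Y n)) θ) atTop
      (nhds ((Real.exp (-(σ ^ α * |θ| ^ α)) : ℝ) : ℂ)) := by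
    intro θ
    have h1 := hf (c * θ)
    rw [abs_mul, abs_of_pos hc0, Real.mul_rpow hc0.le (abs_nonneg θ), ← mul_assoc, hcα] at h1
    refine h1.congr fun n => ?_
    rw [charFun_map_eq_charFn (hYm n).aemeasurable]
    refine integral_congr_ae (Eventually.of_forall fun x => ?_)
    simp only [hY, birkhoffSum, ← Finset.mul_sum]
    congr 1
    ring
  have hprob : ∀ n, IsProbabilityMeasure (m.map (Y n)) := fun n =>
    Measure.isProbabilityMeasure_map (hYm n).aemeasurable
  obtain ⟨ν, hν⟩ := exists_probabilityMeasure_charFun_eq (μ := fun n => ⟨m.map (Y n), hprob n⟩)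
    (g := fun θ => ((Real.exp (-(σ ^ α * |θ| ^ α)) : ℝ) : ℂ))
    (by
      have h1 : Continuous fun θ : ℝ => |θ| ^ α :=
        continuous_abs.rpow_const fun _ => Or.inr hα₀.le
      exact (Complex.continuous_ofReal.comp
        (Real.continuous_exp.comp (continuous_const.mul h1).neg)).continuousAt)
    hchar
  refine ⟨fun x => c * f x, hgm, ν, hν, fun n => (hYm n).aemeasurable, by fun_prop, ?_⟩
  refine ProbabilityMeasure.tendsto_of_tendsto_charFun fun θ => ?_
  have e : charFun ((ν : Measure ℝ).map fun y => y) θ = charFun (ν : Measure ℝ) θ := by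
    rw [Measure.map_id']
  refine (hchar θ).trans_eq ?_
  change _ = nhds (charFun ((ν : Measure ℝ).map fun y => y) θ)
  rw [e, hν]
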